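/- All graphs are finite and simple, and $\ell\ge 5$ is a fixed integer. The length of a path or cycle is its number of edges; "long" means of length at least $\ell$; the interior $P^*$ of a path $P$ is the set of its vertices that are not ends. A hole of $G$ is an induced cycle of $G$ of length at least four. Let $Q_1,Q_2,P$ be induced paths of $G$ between the same two vertices, where $Q_1,Q_2$ have different parity, $P$ has length at least $\ell$, and no vertex of $P^*$ equals or is adjacent to a vertex of $Q_1^*\cup Q_2^*$. They form a long jewel, of order $\max(|V(Q_1)|,|V(Q_2)|)$. A long pyramid is formed by induced paths $P_1,P_2,P_3$ of $G$, where $P_i$ is between $v_0$ and $v_i\ne v_0$, that pairwise meet only in $v_0$, at least two of which have length at least $\ell$, such that $v_1,v_2,v_3$ are pairwise adjacent and, for $i<j$, the only edge between $V(P_i)\setminus\{v_0\}$ and $V(P_j)\setminus\{v_0\}$ is $v_iv_j$. The graph $G$ is a candidate if it contains no long pyramid, no long jewel of order at most $\ell+2$, and no long odd hole of length at most $2\ell+2$. Let $G$ be a candidate and let $C$ be a shortest long odd hole of $G$, that is, a hole of odd length at least $\ell$, of minimum length among all such holes. A path of $C$ is a path that is a subgraph of $C$. A vertex $v\notin V(C)$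 is $C$-major if no three-vertex path of $C$ contains all the neighbours of $v$ in $V(C)$. Let $\mathcal{D}$ be the set of all paths of $C$ such that some $C$-major vertex is adjacent to both ends of the path and to none of its internal vertices. A base is a pair $(x,D)$ where $D$ is a member of $\mathcal{D}$ that is maximal under inclusion, and $x$ is a $C$-major vertex adjacent to both ends of $D$ and to none of its internal vertices. It is remote if $D$ has length at least $2\ell$ and no $C$-major vertex different from $x$ has a neighbour $w\in V(C)$ at distance in $C$ less than $\ell$ from an end of $D$. For a $C$-major vertex $v\ne x$ nonadjacent to $x$, an $(x,v)$-gap is a path $P$ of $C$ such that $V(P)$ is the interior of an induced path of $G$ between $x$ and $v$; and $v$ has even $x$-parity if all $(x,v)$-gaps have even length. A path $P$ of $C$ catches a vertex $v$ if $v\notin V(P)$ and $v$ is adjacent to an internal vertex of $P$. A set $\mathcal{F}$ of paths of $C$ catches $v$ if some member of $\mathcal{F}$ catches $v$, and the cost of $\mathcal{F}$ is the number of vertices in the union of its members. Theorem. Let $C$ be a shortest long odd hole in a candidate $G$, and let $(x,D)$ be a remote base. Then there is a set of paths of $C$, with cost at most $5\ell+12$, that catches every $C$-major vertex $v\ne x$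 that is nonadjacent to $x$ and has even $x$-parity. -/

import Mathlib

namespace LongOddHole

open SimpleGraph

variable {V : Type*} {G : SimpleGraph V}

/-- A walk is an induced path: a path whose vertices span no further edges of the graph. -/
def IsInducedPath {a b : V} (P : G.Walk a b) : Prop :=
  P.IsPath ∧ P.toSubgraph.IsInduced

/-- The interior of a path: the set of its vertices that are not ends. -/
def interior {a b : V} (P : G.Walk a b) : Set V :=
  {w | w ∈ P.support ∧ w ≠ a ∧ w ≠ b}

/-- A hole: an induced cycle of length at least four. It is represented by a closed walk that
traverses it once, from an arbitrary starting vertex. -/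
def IsHole {u : V} (C : G.Walk u u) : Prop :=
  C.IsCycle ∧ C.toSubgraph.IsInduced ∧ 4 ≤ C.length

/-- A hole of odd length at least `ℓ`. -/
def IsLongOddHole (ℓ : ℕ) {u : V} (C : G.Walk u u) : Prop :=
  IsHole C ∧ ℓ ≤ C.length ∧ Odd C.length

/-- A long odd hole of minimum length. -/
def IsShortestLongOddHole (ℓ : ℕ) {u : V} (C : G.Walk u u) : Prop :=
  IsLongOddHole ℓ C ∧
    ∀ (u' : V) (C' : G.Walk u' u'), IsLongOddHole ℓ C' → C.length ≤ C'.length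

/-- `Q₁`, `Q₂`, `P` form a long jewel (of order `max (|V(Q₁)|, |V(Q₂)|)`). -/
def FormLongJewel (ℓ : ℕ) {a b : V} (Q₁ Q₂ P : G.Walk a b) : Prop :=
  IsInducedPath Q₁ ∧ IsInducedPath Q₂ ∧ IsInducedPath P ∧
    Q₁.length % 2 ≠ Q₂.length % 2 ∧ ℓ ≤ P.length ∧
    ∀ p ∈ interior P, ∀ q ∈ interior Q₁ ∪ interior Q₂, p ≠ q ∧ ¬ G.Adj p q

/-- `P 0`, `P 1`, `P 2` form a long pyramid with apex `apex` and base `{v 0, v 1, v 2}`. -/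
def FormLongPyramid (ℓ : ℕ) {apex : V} {v : Fin 3 → V} (P : ∀ i, G.Walk apex (v i)) : Prop :=
  (∀ i, IsInducedPath (P i)) ∧
    (∀ i j, i ≠ j → ∀ w, w ∈ (P i).support → w ∈ (P j).support → w = apex) ∧
    (∀ i, v i ≠ apex) ∧
    (∃ i j, i ≠ j ∧ ℓ ≤ (P i).length ∧ ℓ ≤ (P j).length) ∧
    (∀ i j, i ≠ j → G.Adj (v i) (v j)) ∧
    (∀ i j, i ≠ j → ∀ w ∈ (P i).support, ∀ w' ∈ (P j).support, w ≠ apex → w' ≠ apex →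
      G.Adj w w' → w = v i ∧ w' = v j)

/-- A candidate: a graph with no long pyramid, no long jewel of order at most `ℓ + 2`, and no
long odd hole of length at most `2 * ℓ + 2`. -/
def IsCandidate (ℓ : ℕ) (G : SimpleGraph V) : Prop :=
  (¬ ∃ (apex : V) (v : Fin 3 → V) (P : ∀ i, G.Walk apex (v i)), FormLongPyramid ℓ P) ∧
  (¬ ∃ (a b : V) (Q₁ Q₂ P : G.Walk a b), FormLongJewel ℓ Q₁ Q₂ P ∧
      max Q₁.support.length Q₂.support.length ≤ ℓ + 2) ∧
  (¬ ∃ (u : V) (C : G.Walk u u), IsLongOddHole ℓ C ∧ C.length ≤ 2 * ℓ + 2)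

/-- `P` is a path of the cycle `C`, that is, a path that is a subgraph of `C`. -/
def IsPathOf {u : V} (C : G.Walk u u) {a b : V} (P : G.Walk a b) : Prop :=
  P.IsPath ∧ P.toSubgraph ≤ C.toSubgraph

/-- `v` is `C`-major: it is not in `C`, and no three-vertex path of `C` contains all its
neighbours in `C`. -/
def IsMajor {u : V} (C : G.Walk u u) (v : V) : Prop :=
  v ∉ C.support ∧
    ¬ ∃ (a b : V) (P : G.Walk a b), IsPathOf C P ∧ P.length = 2 ∧
      ∀ w ∈ C.support, G.Adj v w → w ∈ P.support

/-- `P` is a path of `C` such that `x` is adjacent to both ends of `P` and to no internal vertex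
of `P`. -/
def Spans {u : V} (C : G.Walk u u) (x : V) {a b : V} (P : G.Walk a b) : Prop :=
  IsPathOf C P ∧ G.Adj x a ∧ G.Adj x b ∧ ∀ w ∈ interior P, ¬ G.Adj x w

/-- `(x, D)` is a base for `C`: `D` is maximal under inclusion among the paths of `C` such that
some `C`-major vertex is adjacent to both ends and to no internal vertex, and `x` is such a
vertex for `D`. -/
def IsBase {u : V} (C : G.Walk u u) (x : V) {d₁ d₂ : V} (D : G.Walk d₁ d₂) : Prop :=
  IsMajor C x ∧ Spans C x D ∧
    ∀ (y : V) (a b : V) (P : G.Walk a b), IsMajor C y → Spans C y P →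
      D.toSubgraph ≤ P.toSubgraph → P.toSubgraph = D.toSubgraph

/-- A base `(x, D)` is remote if `D` has length at least `2 * ℓ`, and every neighbour in `C` of a
`C`-major vertex other than `x` has distance in `C` at least `ℓ` from both ends of `D`. -/
def IsRemoteBase (ℓ : ℕ) {u : V} (C : G.Walk u u) (x : V) {d₁ d₂ : V} (D : G.Walk d₁ d₂) :
    Prop :=
  IsBase C x D ∧ 2 * ℓ ≤ D.length ∧
    ¬ ∃ v w : V, IsMajor C v ∧ v ≠ x ∧ w ∈ C.support ∧ G.Adj v w ∧
      (C.toSubgraph.spanningCoe.dist w d₁ < ℓ ∨ C.toSubgraph.spanningCoe.dist w d₂ < ℓ)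

/-- `P` is an `(x, y)`-gap, for distinct nonadjacent `x`, `y`: a path of `C` whose vertex set is
the interior of an induced path of `G` between `x` and `y`. -/
def IsGap {u : V} (C : G.Walk u u) (x y : V) {a b : V} (P : G.Walk a b) : Prop :=
  IsPathOf C P ∧ ∃ R : G.Walk x y, IsInducedPath R ∧ interior R = {w | w ∈ P.support}

/-- `v` has even `x`-parity: all `(x, v)`-gaps are even. (For distinct nonadjacent `C`-major
vertices `x`, `v` there is always such a gap.) -/
def HasEvenParity {u : V} (C : G.Walk u u) (x v : V) : Prop :=
  ∀ (a b : V) (P : G.Walk a b), IsGap C x v P → Even P.length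

/-- A path of the cycle `C`, as a bundled object. -/
structure PathOf {u : V} (C : G.Walk u u) where
  /-- one end -/
  src : V
  /-- the other end -/
  tgt : V
  /-- the path -/
  walk : G.Walk src tgt
  isPathOf : IsPathOf C walk

/-- A path catches `v` if `v` is not in the path and is adjacent to an internal vertex of it. -/
def PathOf.Catches {u : V} {C : G.Walk u u} (P : PathOf C) (v : V) : Prop :=
  v ∉ P.walk.support ∧ ∃ w ∈ interior P.walk, G.Adj v w

/-- The cost of a set of paths of `C`: the number of vertices in their union. -/
noncomputable def cost {u : V} {C : G.Walk u u} (F : Set (PathOf C)) : ℕ :=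
  Set.ncard {w : V | ∃ P ∈ F, w ∈ P.walk.support}

end LongOddHole

namespace LongOddHole

open SimpleGraph

variable {V : Type*} {G : SimpleGraph V}

/-! Number `C` by the integers so that `D` is `c (-k), …, c 0` and the rest, `E`, is `c 0, …, c L`.
The basic tool is `Frame.no_closure`: an induced path on an even number of vertices closed up by one
vertex is an odd hole, which is impossible if it is long and shorter than `C`. Hence `k` is even and
`L` is odd, and consecutive neighbours of a vertex at odd distance along `C` are close
(`Frame.close_of_odd`).

Maximality of `D` gives each even major vertex a neighbour in `D`. Even parity then forces its first
neighbour in `E` to have even index and its last one odd index, so its neighbours change parity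
somewhere along `E`.

Two facts relate pairs of even major vertices that have gaps to `x` avoiding each other. If
adjacent, they have the same first neighbour in `D` (`Frame.firstD_eq`). If nonadjacent, every odd
gap in `E` between them is short (`Frame.gap_le`).

The catching paths come from an extremal choice in `Frame.exists_positions`. Relative to an even
neighbour `c h` of `x`, a vertex `v` leaves at an odd position `m` before `h`, and a vertex `u`
enters at an even position `z` after `h`. The pair `(h, z)` is taken latest and then `m` earliest.
Let `w` have no neighbour near `c m`, `c z` and the first neighbour `c g` of `x` from `c m` on, and
miss the common first neighbour of `v` and `u` in `D`. Then `Frame.no_mark_between` shows that `w`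
has no neighbour from `c m` to `c z`; the parity arguments leave only configurations that contain a
long pyramid. So `w` leaves at an odd position earlier than `v` or enters later than `u`, against
the choice. If no vertex enters late enough, a single interval meets the neighbours of all even
major vertices. -/

/-! ### Induced paths as vertex lists, and the holes and pyramids built from them -/

/-- `IndPath G a b l`: the list `l` is the sequence of vertices of an induced path of `G` from
`a` to `b`. -/
inductive IndPath (G : SimpleGraph V) : V → V → List V → Prop
  | single (a : V) : IndPath G a a [a]
  | cons {a b d : V} {l : List V} : G.Adj a b → IndPath G b d l →
      (∀ y ∈ l, y ≠ b → a ≠ y ∧ ¬ G.Adj a y) → IndPath G a d (a :: l)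

namespace IndPath

theorem right_mem {a b : V} {l : List V} (h : IndPath G a b l) : b ∈ l := by
  induction h with
  | single => simp
  | cons _ _ _ ih => exact List.mem_cons_of_mem _ ih

theorem append {a b a' b' : V} {l₁ l₂ : List V} (h₁ : IndPath G a b l₁)
    (h₂ : IndPath G a' b' l₂) (hba : G.Adj b a')
    (hx : ∀ y ∈ l₁, ∀ z ∈ l₂, (y = b ∧ z = a') ∨ (y ≠ z ∧ ¬ G.Adj y z)) :
    IndPath G a b' (l₁ ++ l₂) := by
  induction h₁ with
  | single a =>
    refine .cons hba h₂ fun y hy hne => ?_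
    rcases hx a (by simp) y hy with h | h
    · exact absurd h.2 hne
    · exact h
  | @cons a b d l hab hp hl ih =>
    refine .cons hab (ih hba fun y hy z hz => hx y (List.mem_cons_of_mem _ hy) z hz)
      fun y hy hne => ?_
    rcases List.mem_append.1 hy with hy | hy
    · exact hl y hy hne
    · rcases hx a (by simp) y hy with h | h
      · obtain ⟨rfl, rfl⟩ := h
        exfalso
        have := hp.right_mem
        by_cases hab' : a = b
        · exact hab.ne hab'
        · exact (hl a this hab').1 rfl
      · exact h

theorem reverse {a b : V} {l : List V} (h : IndPath G a b l) : IndPath G b a l.reverse := by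
  induction h with
  | single a => exact .single a
  | @cons a b d l hab hp hl ih =>
    rw [List.reverse_cons]
    refine ih.append (.single a) hab.symm fun y hy z hz => ?_
    simp only [List.mem_singleton] at hz
    subst hz
    by_cases hyb : y = b
    · exact Or.inl ⟨hyb, rfl⟩
    · have := hl y (List.mem_reverse.1 hy) hyb
      exact Or.inr ⟨this.1.symm, fun h => this.2 h.symm⟩

theorem exists_walk {a b : V} {l : List V} (h : IndPath G a b l) :
    ∃ P : G.Walk a b, P.support = l ∧ IsInducedPath P := by
  induction h with
  | single a =>
    refine ⟨.nil, rfl, Walk.IsPath.nil, ?_⟩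
    intro v hv w hw hvw
    simp at hv hw
    subst hv; subst hw
    exact absurd hvw (G.irrefl)
  | @cons a b d l hab hp hl ih =>
    obtain ⟨P, rfl, hP, hI⟩ := ih
    have ha : a ∉ P.support := by
      intro ha
      by_cases h' : a = b
      · exact hab.ne h'
      · exact (hl a ha h').1 rfl
    refine ⟨.cons hab P, rfl, ?_, ?_⟩
    · rw [Walk.cons_isPath_iff]; exact ⟨hP, ha⟩
    · have key : ∀ w ∈ P.support, G.Adj a w → w = b := fun w hw haw => by
        by_contra hne
        exact (hl w hw hne).2 haw
      intro v hv w hw hvw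
      simp only [Walk.mem_verts_toSubgraph, Walk.support_cons, List.mem_cons] at hv hw
      simp only [Walk.toSubgraph, Subgraph.sup_adj, subgraphOfAdj_adj]
      rcases hv with rfl | hv <;> rcases hw with rfl | hw
      · exact absurd hvw G.irrefl
      · left; rw [key w hw hvw]
      · left; rw [key v hv hvw.symm]; exact Sym2.eq_swap
      · right; exact hI (by simpa using hv) (by simpa using hw) hvw

/-- An induced path closed up by a vertex adjacent to exactly its two ends gives a hole. -/
theorem exists_hole {a b y : V} {l : List V} (h : IndPath G a b l) (hl : 3 ≤ l.length)
    (ha : G.Adj y a) (hb : G.Adj y b)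
    (hy : ∀ z ∈ l, z ≠ y ∧ (G.Adj y z → z = a ∨ z = b)) :
    ∃ C : G.Walk y y, IsHole C ∧ C.length = l.length + 1 := by
  obtain ⟨P, rfl, hP, hI⟩ := h.exists_walk
  have hy' : y ∉ P.support := fun h => (hy y h).1 rfl
  have hlen := P.length_support
  have hab : a ≠ b := by
    rintro rfl
    have := Walk.length_eq_zero_iff.2 (Walk.isPath_iff_nil.1 hP)
    omega
  refine ⟨.cons ha (P.concat hb.symm), ⟨?_, ?_, ?_⟩, ?_⟩
  · rw [Walk.cons_isCycle_iff, Walk.concat_isPath_iff]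
    refine ⟨⟨hP, hy'⟩, ?_⟩
    rw [Walk.edges_concat]
    simp only [List.concat_eq_append, List.mem_append, List.mem_singleton, not_or]
    refine ⟨fun he => hy' (Walk.fst_mem_support_of_mem_edges _ he), ?_⟩
    intro he
    rw [Sym2.eq_iff] at he
    rcases he with ⟨rfl, _⟩ | ⟨_, h2⟩
    · exact hb.ne rfl
    · exact hab h2
  · intro v hv w hw hvw
    simp only [Walk.mem_verts_toSubgraph, Walk.support_cons, Walk.support_concat,
     List.mem_cons, List.mem_append, List.not_mem_nil, or_false] at hv hw
    have hadj : ∀ v w, (Walk.cons ha (P.concat hb.symm)).toSubgraph.Adj v w ↔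
        s(y, a) = s(v, w) ∨ P.toSubgraph.Adj v w ∨ s(b, y) = s(v, w) := by
      intro v w
      rw [← Subgraph.mem_edgeSet, Walk.mem_edges_toSubgraph, Walk.edges_cons, Walk.edges_concat,
        ← Subgraph.mem_edgeSet, Walk.mem_edges_toSubgraph]
      simp only [List.concat_eq_append, List.mem_cons, List.mem_append, List.not_mem_nil, or_false]
      constructor <;> rintro (h | h | h) <;> simp [h]
    rw [hadj]
    have key : ∀ w ∈ P.support, G.Adj y w → s(y, a) = s(y, w) ∨ s(b, y) = s(y, w) := by
      intro w hw h
      rcases (hy w hw).2 h with rfl | rfl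
      · left; rfl
      · right; exact Sym2.eq_swap
    replace hv : v = y ∨ v ∈ P.support := by tauto
    replace hw : w = y ∨ w ∈ P.support := by tauto
    rcases hv with rfl | hv <;> rcases hw with rfl | hw
    · exact absurd hvw G.irrefl
    · rcases key w hw hvw with h | h <;> tauto
    · rw [Sym2.eq_swap (a := v)]
      rcases key v hv hvw.symm with h | h <;> tauto
    · right; left; exact hI (by simpa using hv) (by simpa using hw) hvw
  · simp only [Walk.length_cons, Walk.length_concat]; omega
  · simp only [Walk.length_cons, Walk.length_concat]; omega

end IndPath

/-- The condition on two legs `l`, `l'` of a pyramid with apex `o` and base ends `b`, `b'`: apart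
from the apex and the edge `bb'`, they are disjoint and anticomplete. -/
def PyramidCross (G : SimpleGraph V) (o b b' : V) (l l' : List V) : Prop :=
  ∀ y ∈ l, ∀ z ∈ l', y = o ∨ z = o ∨ (y = b ∧ z = b') ∨ (y ≠ z ∧ ¬ G.Adj y z)

theorem PyramidCross.symm {o b b' : V} {l l' : List V} (h : PyramidCross G o b b' l l') :
    PyramidCross G o b' b l' l := by
  intro y hy z hz
  rcases h z hz y hy with h | h | h | h
  · tauto
  · tauto
  · tauto
  · exact Or.inr (Or.inr (Or.inr ⟨h.1.symm, fun h' => h.2 h'.symm⟩))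

/-- Only two legs of a long pyramid must be long, so the legs are listed with the long ones first.
The bound `ℓ + 1` counts vertices. -/
theorem exists_longPyramid {ℓ : ℕ} {o b₀ b₁ b₂ : V} {l₀ l₁ l₂ : List V}
    (h₀ : IndPath G o b₀ l₀) (h₁ : IndPath G o b₁ l₁) (h₂ : IndPath G o b₂ l₂)
    (n₀ : b₀ ≠ o) (n₁ : b₁ ≠ o) (n₂ : b₂ ≠ o)
    (a₀₁ : G.Adj b₀ b₁) (a₀₂ : G.Adj b₀ b₂) (a₁₂ : G.Adj b₁ b₂)
    (x₀₁ : PyramidCross G o b₀ b₁ l₀ l₁) (x₀₂ : PyramidCross G o b₀ b₂ l₀ l₂)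
    (x₁₂ : PyramidCross G o b₁ b₂ l₁ l₂)
    (long₀ : ℓ + 1 ≤ l₀.length) (long₁ : ℓ + 1 ≤ l₁.length) :
    ∃ (apex : V) (v : Fin 3 → V) (P : ∀ i, G.Walk apex (v i)), FormLongPyramid ℓ P := by
  obtain ⟨P₀, rfl, i₀⟩ := h₀.exists_walk
  obtain ⟨P₁, rfl, i₁⟩ := h₁.exists_walk
  obtain ⟨P₂, rfl, i₂⟩ := h₂.exists_walk
  rw [Walk.length_support] at long₀ long₁
  let v : Fin 3 → V := ![b₀, b₁, b₂]
  let P : ∀ i, G.Walk o (v i) := fun i => match i with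
    | 0 => P₀
    | 1 => P₁
    | 2 => P₂
  have cross : ∀ i j, i ≠ j → PyramidCross G o (v i) (v j) (P i).support (P j).support := by
    intro i j hij
    fin_cases i <;> fin_cases j <;> first | exact absurd rfl hij | skip
    exacts [x₀₁, x₀₂, x₀₁.symm, x₁₂, x₀₂.symm, x₁₂.symm]
  have hvadj : ∀ i j, i ≠ j → G.Adj (v i) (v j) := by
    intro i j hij
    fin_cases i <;> fin_cases j <;> first | exact absurd rfl hij | skip
    exacts [a₀₁, a₀₂, a₀₁.symm, a₁₂, a₀₂.symm, a₁₂.symm]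
  refine ⟨o, v, P, ?_, ?_, ?_, ?_, hvadj, ?_⟩
  · intro i; fin_cases i
    exacts [i₀, i₁, i₂]
  · intro i j hij w hw hw'
    rcases cross i j hij w hw w hw' with h | h | h | h
    · exact h
    · exact h
    · exact absurd (h.1.symm.trans h.2) (hvadj i j hij).ne
    · exact absurd rfl h.1
  · intro i; fin_cases i
    exacts [n₀, n₁, n₂]
  · exact ⟨0, 1, by decide, Nat.le_of_add_le_add_right long₀, Nat.le_of_add_le_add_right long₁⟩
  · intro i j hij w hw w' hw' h h' hadj
    rcases cross i j hij w hw w' hw' with h1 | h1 | h1 | h1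
    · exact absurd h1 h
    · exact absurd h1 h'
    · exact h1
    · exact absurd hadj h1.2

/-! ### Induced cycles in integer coordinates -/

/-- `c` parametrises an induced cycle of length `n` by the integers, periodically. -/
structure IsCyc (G : SimpleGraph V) (n : ℤ) (c : ℤ → V) : Prop where
  four_le : 4 ≤ n
  per : ∀ i, c (i + n) = c i
  inj : ∀ i j, c i = c j → n ∣ i - j
  adj : ∀ i j, G.Adj (c i) (c j) ↔ n ∣ i - j - 1 ∨ n ∣ i - j + 1

namespace IsCyc
variable {n : ℤ} {c : ℤ → V}

theorem neg (h : IsCyc G n c) : IsCyc G n (fun t => c (-t)) where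
  four_le := h.four_le
  per i := by
    have := h.per (-(i + n))
    rw [← this]; congr 1; ring
  inj i j e := by
    obtain ⟨r, hr⟩ := h.inj _ _ e
    exact ⟨-r, by linear_combination -hr⟩
  adj i j := by
    rw [h.adj, or_comm]
    refine or_congr ⟨?_, ?_⟩ ⟨?_, ?_⟩ <;> rintro ⟨r, hr⟩ <;>
      exact ⟨-r, by linear_combination -hr⟩

theorem shift (h : IsCyc G n c) (s : ℤ) : IsCyc G n (fun t => c (s + t)) where
  four_le := h.four_le
  per i := by rw [← add_assoc]; exact h.per _
  inj i j e := by simpa using h.inj _ _ e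
  adj i j := by rw [h.adj]; simp

theorem per_mul (h : IsCyc G n c) (i r : ℤ) : c (i + n * r) = c i := by
  induction r using Int.induction_on with
  | zero => simp
  | succ r ih => rw [mul_add, mul_one, ← add_assoc, h.per, ih]
  | pred r ih => rw [← h.per, ← ih]; congr 1; ring

theorem eq_of_dvd (h : IsCyc G n c) {i j : ℤ} (hd : n ∣ i - j) : c i = c j := by
  obtain ⟨r, hr⟩ := hd
  rw [← h.per_mul j r]; congr 1; linarith

theorem adj_succ (h : IsCyc G n c) (i : ℤ) : G.Adj (c i) (c (i + 1)) := by
  rw [h.adj]; right; simp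

/-- For indices at most one period apart, divisibility by `n` reduces to a few linear alternatives.
-/
theorem eq_cases (h : IsCyc G n c) {i j : ℤ} (e : c i = c j) (h1 : i - j ≤ n) (h2 : j - i ≤ n) :
    i = j ∨ i - j = n ∨ j - i = n := by
  have := h.four_le
  obtain ⟨r, hr⟩ := h.inj _ _ e
  have : -1 ≤ r := by by_contra hh; nlinarith
  have : r ≤ 1 := by by_contra hh; nlinarith
  obtain rfl | rfl | rfl : r = -1 ∨ r = 0 ∨ r = 1 := by omega
  all_goals omega

theorem adj_cases (h : IsCyc G n c) {i j : ℤ} (e : G.Adj (c i) (c j)) (h1 : i - j ≤ n)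
    (h2 : j - i ≤ n) : i - j = 1 ∨ j - i = 1 ∨ i - j = n - 1 ∨ j - i = n - 1 := by
  have h4 := h.four_le
  rcases (h.adj i j).1 e with ⟨r, hr⟩ | ⟨r, hr⟩
  · have : -2 < r := by by_contra hh; nlinarith
    have : r ≤ 1 := by by_contra hh; nlinarith
    obtain rfl | rfl | rfl : r = -1 ∨ r = 0 ∨ r = 1 := by omega
    all_goals omega
  · have : -2 < r := by by_contra hh; nlinarith
    have : r ≤ 1 := by by_contra hh; nlinarith
    obtain rfl | rfl | rfl : r = -1 ∨ r = 0 ∨ r = 1 := by omega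
    all_goals omega

theorem sep (h : IsCyc G n c) {i j : ℤ} (h1 : 2 ≤ i - j) (h2 : i - j ≤ n - 2) :
    c i ≠ c j ∧ ¬ G.Adj (c i) (c j) := by
  constructor
  · intro e; have := h.eq_cases e (by omega) (by omega); omega
  · intro e; have := h.adj_cases e (by omega) (by omega); omega

theorem sep' (h : IsCyc G n c) {i j : ℤ} (h1 : 2 ≤ j - i) (h2 : j - i ≤ n - 2) :
    c i ≠ c j ∧ ¬ G.Adj (c i) (c j) :=
  ⟨(h.sep h1 h2).1.symm, fun e => (h.sep h1 h2).2 e.symm⟩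

/-- The bound `n - 2` leaves out at least one vertex of the cycle; with none left out, the two ends
would be adjacent and the path not induced. -/
theorem seg_up (h : IsCyc G n c) (i j : ℤ) (h1 : i ≤ j) (h2 : j - i ≤ n - 2) :
    ∃ l, IndPath G (c i) (c j) l ∧ (∀ y, y ∈ l ↔ ∃ t, i ≤ t ∧ t ≤ j ∧ y = c t) ∧
      (l.length : ℤ) = j - i + 1 := by
  obtain ⟨m, rfl⟩ : ∃ m : ℕ, i = j - m := ⟨(j - i).toNat, by omega⟩
  clear h1
  induction m with
  | zero =>
    refine ⟨[c j], by simpa using IndPath.single (G := G) (c j), fun y => ?_, by simp⟩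
    simp only [List.mem_singleton, Nat.cast_zero, sub_zero]
    constructor
    · rintro rfl; exact ⟨j, le_rfl, le_rfl, rfl⟩
    · rintro ⟨t, h1, h2, rfl⟩; rw [le_antisymm h2 h1]
  | succ m ih =>
    push_cast at h2 ⊢
    obtain ⟨l, hl, ml, nl⟩ := ih (by omega)
    refine ⟨c (j - (m + 1)) :: l, .cons ?_ hl ?_, fun y => ?_, by simp; omega⟩
    · have := h.adj_succ (j - (m + 1)); rwa [show j - ((m : ℤ) + 1) + 1 = j - m by ring] at this
    · intro y hy hne
      obtain ⟨t, ht1, ht2, rfl⟩ := (ml y).1 hy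
      have : t ≠ j - m := by rintro rfl; exact hne rfl
      exact h.sep' (by omega) (by omega)
    · rw [List.mem_cons, ml]
      constructor
      · rintro (rfl | ⟨t, h1, h2, rfl⟩)
        · exact ⟨_, le_rfl, by omega, rfl⟩
        · exact ⟨t, by omega, h2, rfl⟩
      · rintro ⟨t, h1, h2, rfl⟩
        by_cases ht : t = j - (m + 1)
        · left; rw [ht]
        · right; exact ⟨t, by omega, h2, rfl⟩

theorem seg_down (h : IsCyc G n c) (i j : ℤ) (h1 : i ≤ j) (h2 : j - i ≤ n - 2) :
    ∃ l, IndPath G (c j) (c i) l ∧ (∀ y, y ∈ l ↔ ∃ t, i ≤ t ∧ t ≤ j ∧ y = c t) ∧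
      (l.length : ℤ) = j - i + 1 := by
  obtain ⟨l, hl, ml, nl⟩ := h.seg_up i j h1 h2
  exact ⟨l.reverse, hl.reverse, by simpa using ml, by simpa using nl⟩

end IsCyc

/-! ### The hole split by a base, and gaps along it -/

/-- Coordinates on a shortest long odd hole `c` of length `n = k + L`, split by a base `(x, D)`
into the path `D`, with vertices `c (-k), …, c 0`, and the rest, with vertices `c 0, …, c L`. -/
structure Frame (G : SimpleGraph V) (ℓ : ℕ) (n k L : ℤ) (c : ℤ → V) (x : V) : Prop where
  five_le : 5 ≤ ℓ
  cyc : IsCyc G n c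
  noPyr : ¬ ∃ (apex : V) (v : Fin 3 → V) (P : ∀ i, G.Walk apex (v i)), FormLongPyramid ℓ P
  noHole : ∀ (y : V) (C : G.Walk y y), IsHole C → Odd C.length → ℓ ≤ C.length → n ≤ C.length
  n_eq : n = k + L
  k_ge : 2 * (ℓ : ℤ) ≤ k
  L_ge : 3 ≤ L
  k_even : k % 2 = 0
  L_odd : L % 2 = 1
  x_off : ∀ t, c t ≠ x
  x_zero : G.Adj x (c 0)
  x_L : G.Adj x (c L)
  x_D : ∀ t, -k < t → t < 0 → ¬ G.Adj x (c t)

/-- `v` is a major vertex other than `x`, nonadjacent to `x` and of even `x`-parity, in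
coordinates. -/
structure EvenMajor (G : SimpleGraph V) (ℓ : ℕ) (n k L : ℤ) (c : ℤ → V) (x v : V) : Prop where
  off : ∀ t, c t ≠ v
  ne_x : v ≠ x
  not_x : ¬ G.Adj x v
  major : ∀ t, ∃ s, -k < s ∧ s ≤ L ∧ G.Adj v (c s) ∧ ¬ (n ∣ s - t) ∧ ¬ (n ∣ s - t - 1) ∧
    ¬ (n ∣ s - t + 1)
  loc : ∀ t, -k ≤ t → t ≤ L → G.Adj v (c t) → (ℓ ≤ t ∧ t ≤ L - ℓ) ∨ (ℓ - k ≤ t ∧ t ≤ -ℓ)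
  markD : ∃ t, -k ≤ t ∧ t ≤ 0 ∧ G.Adj v (c t)
  gap_up : ∀ i j, i ≤ j → j - i ≤ n - 2 → G.Adj x (c i) → G.Adj v (c j) →
    (∀ t, i < t → t ≤ j → ¬ G.Adj x (c t)) → (∀ t, i ≤ t → t < j → ¬ G.Adj v (c t)) →
    (j - i) % 2 = 0
  gap_down : ∀ i j, i ≤ j → j - i ≤ n - 2 → G.Adj v (c i) → G.Adj x (c j) →
    (∀ t, i < t → t ≤ j → ¬ G.Adj v (c t)) → (∀ t, i ≤ t → t < j → ¬ G.Adj x (c t)) →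
    (j - i) % 2 = 0

/-- An induced path on an even number of vertices, at least `ℓ - 1` and less than `n - 1`, cannot
be closed up to a hole by one vertex. -/
theorem Frame.no_closure {ℓ : ℕ} {n k L : ℤ} {c : ℤ → V} {x : V} (F : Frame G ℓ n k L c x)
    {a b y : V} {l : List V} (h : IndPath G a b l) (hl : (ℓ : ℤ) ≤ l.length + 1)
    (hn : (l.length : ℤ) + 1 < n) (hp : (l.length : ℤ) % 2 = 0)
    (ha : G.Adj y a) (hb : G.Adj y b)
    (hy : ∀ z ∈ l, z ≠ y ∧ (G.Adj y z → z = a ∨ z = b)) : False := by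
  have h5 := F.five_le
  obtain ⟨C, hC, hlen⟩ := h.exists_hole (by omega) ha hb hy
  have := F.noHole y C hC (by rw [Nat.odd_iff]; omega) (by omega)
  omega

/-- Consecutive neighbours at odd distance are close. -/
theorem Frame.close_of_odd {ℓ : ℕ} {n k L : ℤ} {c : ℤ → V} {x : V} (F : Frame G ℓ n k L c x)
    {y : V} (hy : ∀ t, c t ≠ y) {a b : ℤ} (hab : a < b) (hn : b - a ≤ n - 3)
    (ha : G.Adj y (c a)) (hb : G.Adj y (c b)) (hno : ∀ t, a < t → t < b → ¬ G.Adj y (c t))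
    (hodd : (b - a) % 2 = 1) : b - a ≤ ℓ - 3 := by
  by_contra hcon
  obtain ⟨l, hl, ml, nl⟩ := F.cyc.seg_up a b hab.le (by omega)
  -- The hole would have length `b - a + 2`, odd and less than `n`, so it cannot be long; this is
  -- the source of `ℓ - 3`.
  refine F.no_closure hl (by omega) (by omega) (by omega) ha hb fun z hz => ?_
  obtain ⟨t, h1, h2, rfl⟩ := (ml z).1 hz
  refine ⟨hy t, fun h => ?_⟩
  by_contra hh
  have h3 : a ≠ t := by rintro rfl; simp at hh
  have h4 : t ≠ b := by rintro rfl; simp at hh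
  exact hno t (by omega) (by omega) h

theorem exists_first {P : ℤ → Prop} {a b : ℤ} (h : ∃ t, a ≤ t ∧ t ≤ b ∧ P t) :
    ∃ t, a ≤ t ∧ t ≤ b ∧ P t ∧ ∀ s, a ≤ s → s < t → ¬ P s := by
  obtain ⟨m, ⟨h1, h2, h3⟩, hm⟩ := Int.exists_least_of_bdd
    (P := fun t => a ≤ t ∧ t ≤ b ∧ P t) ⟨a, fun z hz => hz.1⟩ h
  refine ⟨m, h1, h2, h3, fun s hs hsm hP => ?_⟩
  have := hm s ⟨hs, by omega, hP⟩
  omega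

theorem exists_last {P : ℤ → Prop} {a b : ℤ} (h : ∃ t, a ≤ t ∧ t ≤ b ∧ P t) :
    ∃ t, a ≤ t ∧ t ≤ b ∧ P t ∧ ∀ s, t < s → s ≤ b → ¬ P s := by
  obtain ⟨m, ⟨h1, h2, h3⟩, hm⟩ := Int.exists_greatest_of_bdd
    (P := fun t => a ≤ t ∧ t ≤ b ∧ P t) ⟨b, fun z hz => hz.2.1⟩ h
  refine ⟨m, h1, h2, h3, fun s hs hsm hP => ?_⟩
  have := hm s ⟨by omega, hsm, hP⟩
  omega

/-- Allows either order of the ends. The vertex set is given as a rewriting rule for "every vertex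
satisfies `P`", which turns the conditions for joining paths into conditions on intervals of
indices. -/
theorem IsCyc.seg {n : ℤ} {c : ℤ → V} (h : IsCyc G n c) (i j : ℤ)
    (h2 : max i j - min i j ≤ n - 2) :
    ∃ l, IndPath G (c i) (c j) l ∧
      (∀ P : V → Prop, (∀ y ∈ l, P y) ↔ ∀ t, min i j ≤ t → t ≤ max i j → P (c t)) ∧
      (l.length : ℤ) = max i j - min i j + 1 := by
  have key : ∀ l : List V, (∀ y, y ∈ l ↔ ∃ t, min i j ≤ t ∧ t ≤ max i j ∧ y = c t) →
      ∀ P : V → Prop, (∀ y ∈ l, P y) ↔ ∀ t, min i j ≤ t → t ≤ max i j → P (c t) := by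
    intro l ml P
    constructor
    · intro H t h1 h2; exact H _ ((ml _).2 ⟨t, h1, h2, rfl⟩)
    · intro H y hy; obtain ⟨t, h1, h2, rfl⟩ := (ml y).1 hy; exact H t h1 h2
  rcases le_total i j with hij | hij
  · obtain ⟨l, hl, ml, nl⟩ := h.seg_up i j hij (by omega)
    exact ⟨l, hl, key l (by simpa [hij] using ml), by simp [hij, nl]⟩
  · obtain ⟨l, hl, ml, nl⟩ := h.seg_down j i hij (by omega)
    exact ⟨l, hl, key l (by simpa [hij] using ml), by simp [hij, nl]⟩

/-- The part of the cycle between `c a` and `c b` is the interior of a path from `v` to `w`, which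
is induced if `v` and `w` are nonadjacent. -/
structure Gap (G : SimpleGraph V) (c : ℤ → V) (v w : V) (a b : ℤ) : Prop where
  left : G.Adj v (c a)
  right : G.Adj w (c b)
  left_only : ∀ t, min a b ≤ t → t ≤ max a b → G.Adj v (c t) → t = a
  right_only : ∀ t, min a b ≤ t → t ≤ max a b → G.Adj w (c t) → t = b

theorem Gap.symm {c : ℤ → V} {v w : V} {a b : ℤ} (h : Gap G c v w a b) : Gap G c w v b a :=
  ⟨h.right, h.left, fun t h1 h2 => h.right_only t (by omega) (by omega),
    fun t h1 h2 => h.left_only t (by omega) (by omega)⟩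

/-- `v` has no neighbour between `c a` and `c b`. -/
def Free (G : SimpleGraph V) (c : ℤ → V) (v : V) (a b : ℤ) : Prop :=
  ∀ t, min a b ≤ t → t ≤ max a b → ¬ G.Adj v (c t)

section cells
variable {c : ℤ → V} {v : V} {t e : ℤ}

theorem link_right (off : ∀ t, c t ≠ v) (h : G.Adj v (c t) → t = e) :
    c t = c e ∨ (c t ≠ v ∧ ¬ G.Adj (c t) v) := by
  by_cases hh : G.Adj v (c t)
  · left; rw [h hh]
  · right; exact ⟨off t, fun h' => hh h'.symm⟩

theorem link_left (off : ∀ t, c t ≠ v) (h : G.Adj v (c t) → t = e) :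
    c t = c e ∨ (v ≠ c t ∧ ¬ G.Adj v (c t)) := by
  by_cases hh : G.Adj v (c t)
  · left; rw [h hh]
  · right; exact ⟨(off t).symm, hh⟩

theorem apart_right (off : ∀ t, c t ≠ v) (h : ¬ G.Adj v (c t)) : c t ≠ v ∧ ¬ G.Adj (c t) v :=
  ⟨off t, fun h' => h h'.symm⟩

theorem apart_left (off : ∀ t, c t ≠ v) (h : ¬ G.Adj v (c t)) : v ≠ c t ∧ ¬ G.Adj v (c t) :=
  ⟨(off t).symm, h⟩

end cells

/-! ### Parities of the extreme neighbours of one even major vertex -/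

section
variable {ℓ : ℕ} {n k L : ℤ} {c : ℤ → V} {x v w : V}

theorem Frame.x_negk (F : Frame G ℓ n k L c x) : G.Adj x (c (-k)) := by
  have := F.cyc.per (-k)
  have h := F.x_L
  rwa [← this, show -k + n = L by have := F.n_eq; omega]

namespace EvenMajor

/-- Since `x` has no neighbour inside `D`, the stretch from `c 0` to the nearest neighbour of `v` is
an `(x, v)`-gap, hence even. -/
theorem D_first (F : Frame G ℓ n k L c x) (hv : EvenMajor G ℓ n k L c x v) :
    ∃ p : ℤ, ℓ ≤ p ∧ p ≤ k - ℓ ∧ p % 2 = 0 ∧ G.Adj v (c (-p)) ∧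
      ∀ t, -p < t → t ≤ 0 → ¬ G.Adj v (c t) := by
  have := F.k_ge; have := F.L_ge; have := F.n_eq; have := F.five_le; have := F.k_even
  obtain ⟨t, h1, h2, h3, h4⟩ := exists_last hv.markD
  have hl := hv.loc t h1 (by omega) h3
  refine ⟨-t, by omega, by omega, ?_, by simpa using h3, fun s hs => h4 s (by omega)⟩
  have := hv.gap_down t 0 h2 (by omega) h3 F.x_zero (fun s h5 h6 => h4 s h5 h6)
    (fun s h5 h6 => F.x_D s (by omega) h6)
  omega

/-- The gap argument from the other end `c (-k)`; evenness of `k` makes `q` even too. -/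
theorem D_last (F : Frame G ℓ n k L c x) (hv : EvenMajor G ℓ n k L c x v) :
    ∃ q : ℤ, ℓ ≤ q ∧ q ≤ k - ℓ ∧ q % 2 = 0 ∧ G.Adj v (c (-q)) ∧
      ∀ t, -k ≤ t → t < -q → ¬ G.Adj v (c t) := by
  have := F.k_ge; have := F.L_ge; have := F.n_eq; have := F.five_le; have := F.k_even
  obtain ⟨t, h1, h2, h3, h4⟩ := exists_first hv.markD
  have hl := hv.loc t h1 (by omega) h3
  refine ⟨-t, by omega, by omega, ?_, by simpa using h3, fun s hs => fun h5 => h4 s hs (by omega)⟩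
  have := hv.gap_up (-k) t h1 (by omega) F.x_negk h3
    (fun s h5 h6 => F.x_D s h5 (by omega)) (fun s h5 h6 => h4 s h5 h6)
  omega

/-- Otherwise all neighbours of `v` in `C` lie between `c (-q)` and `c (-p)`. If `q - p ≤ 2`, the
three-vertex path centred at `c (-p - 1)` contains them all. If not, `v` closes the complementary
arc to an odd hole of length `n - (q - p) + 2 < n`. -/
theorem markE (F : Frame G ℓ n k L c x) (hv : EvenMajor G ℓ n k L c x v) :
    ∃ t, 0 ≤ t ∧ t ≤ L ∧ G.Adj v (c t) := by
  have := F.k_ge; have := F.L_ge; have hn := F.n_eq; have := F.five_le; have := F.k_even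
  have := F.L_odd
  by_contra! hno
  obtain ⟨p, hp1, hp2, hp3, hp4, hp5⟩ := hv.D_first F
  obtain ⟨q, hq1, hq2, hq3, hq4, hq5⟩ := hv.D_last F
  have hpq : ∀ s, -k < s → s ≤ L → G.Adj v (c s) → -q ≤ s ∧ s ≤ -p := by
    intro s h1 h2 h3
    constructor
    · by_contra hh; exact hq5 s h1.le (by omega) h3
    · by_contra hh
      rcases le_total s 0 with h | h
      · exact hp5 s (by omega) h h3
      · exact hno s h h2 h3
  have h1 := hpq (-p) (by omega) (by omega) hp4
  by_cases hd : q - p ≤ 2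
  · obtain ⟨s, s1, s2, s3, s4, s5, s6⟩ := hv.major (-p - 1)
    have := hpq s s1 s2 s3
    have : s - (-p - 1) ≠ 0 := fun h => s4 (by rw [h]; simp)
    have : s - (-p - 1) - 1 ≠ 0 := fun h => s5 (by rw [h]; simp)
    have : s - (-p - 1) + 1 ≠ 0 := fun h => s6 (by rw [h]; simp)
    omega
  · have hqn : c (n - q) = c (-q) := by rw [← F.cyc.per (-q)]; congr 1; ring
    obtain ⟨l, hl, ml, nl⟩ := F.cyc.seg (-p) (n - q) (by omega)
    refine F.no_closure (y := v) hl (by omega) (by omega) (by omega) hp4 (hqn ▸ hq4) ?_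
    rw [ml]
    intro t h1 h2
    refine ⟨hv.off t, fun h => ?_⟩
    by_cases htL : t ≤ L
    · have := hpq t (by omega) htL h
      left; congr 1; omega
    · have htn : c (t - n) = c t := by rw [← F.cyc.per (t - n)]; congr 1; ring
      have := hpq (t - n) (by omega) (by omega) (htn ▸ h)
      right; congr 1; omega

/-- The neighbours `c (-p)` and `c a` are consecutive and far apart, so their distance is even; and
`p` is even. -/
theorem E_first (F : Frame G ℓ n k L c x) (hv : EvenMajor G ℓ n k L c x v) :
    ∃ a : ℤ, ℓ ≤ a ∧ a ≤ L - ℓ ∧ a % 2 = 0 ∧ G.Adj v (c a) ∧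
      ∀ t, 0 ≤ t → t < a → ¬ G.Adj v (c t) := by
  have := F.k_ge; have := F.L_ge; have hn := F.n_eq; have := F.five_le; have := F.k_even
  have := F.L_odd
  obtain ⟨p, hp1, hp2, hp3, hp4, hp5⟩ := hv.D_first F
  obtain ⟨a, h1, h2, h3, h4⟩ := exists_first (hv.markE F)
  have hl := hv.loc a (by omega) h2 h3
  refine ⟨a, by omega, by omega, ?_, h3, h4⟩
  by_contra hodd
  have := F.close_of_odd hv.off (a := -p) (b := a) (by omega) (by omega) hp4 h3
    (fun t h5 h6 => by
      rcases le_total t 0 with h | h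
      · exact hp5 t h5 h
      · exact h4 t h h6) (by omega)
  omega

/-- After `c b` the next neighbour of `v` is `c (n - q)`, far away, so the distance is even; `n` is
odd and `q` even. -/
theorem E_last (F : Frame G ℓ n k L c x) (hv : EvenMajor G ℓ n k L c x v) :
    ∃ b : ℤ, ℓ ≤ b ∧ b ≤ L - ℓ ∧ b % 2 = 1 ∧ G.Adj v (c b) ∧
      ∀ t, b < t → t ≤ L → ¬ G.Adj v (c t) := by
  have := F.k_ge; have := F.L_ge; have hn := F.n_eq; have := F.five_le; have := F.k_even
  have := F.L_odd
  obtain ⟨q, hq1, hq2, hq3, hq4, hq5⟩ := hv.D_last F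
  obtain ⟨b, h1, h2, h3, h4⟩ := exists_last (hv.markE F)
  have hl := hv.loc b (by omega) h2 h3
  refine ⟨b, by omega, by omega, ?_, h3, h4⟩
  by_contra hodd
  have hqn : c (n - q) = c (-q) := by rw [← F.cyc.per (-q)]; congr 1; ring
  have := F.close_of_odd hv.off (a := b) (b := n - q) (by omega) (by omega) h3 (hqn ▸ hq4)
    (fun t h5 h6 => by
      rcases le_total t L with h | h
      · exact h4 t h5 h
      · have htn : c (t - n) = c t := by rw [← F.cyc.per (t - n)]; congr 1; ring
        rw [← htn]
        exact hq5 (t - n) (by omega) (by omega)) (by omega)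
  omega

/-- The gaps between `x` and `v` are even. -/
theorem gap_even (F : Frame G ℓ n k L c x) (hv : EvenMajor G ℓ n k L c x v) {a g : ℤ}
    (h : Gap G c v x a g) (h1 : 0 ≤ min a g) (h2 : max a g ≤ L) : (a - g) % 2 = 0 := by
  have := F.k_ge; have hn := F.n_eq; have := F.five_le
  rcases le_total a g with hag | hag
  · have := hv.gap_down a g hag (by omega) h.left h.right
      (fun t h3 h4 h5 => by have := h.left_only t (by omega) (by omega) h5; omega)
      (fun t h3 h4 h5 => by have := h.right_only t (by omega) (by omega) h5; omega)
    omega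
  · have := hv.gap_up g a hag (by omega) h.right h.left
      (fun t h3 h4 h5 => by have := h.right_only t (by omega) (by omega) h5; omega)
      (fun t h3 h4 h5 => by have := h.left_only t (by omega) (by omega) h5; omega)
    omega

end EvenMajor

/-! ### Odd holes through two even major vertices -/

/-- Of two adjacent even major vertices `v`, `w`, with a gap between `w` and `x` free of `v`, the
first neighbour in `D` of `w` does not come after that of `v`. -/
theorem Frame.le_of_adj_of_gap (F : Frame G ℓ n k L c x) (hv : EvenMajor G ℓ n k L c x v)
    (hw : EvenMajor G ℓ n k L c x w) (hvw : G.Adj v w) {p p' a g : ℤ}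
    (hp : ℓ ≤ p ∧ p ≤ k - ℓ ∧ p % 2 = 0) (hpv : G.Adj v (c (-p)))
    (hpv' : ∀ t, -p < t → t ≤ 0 → ¬ G.Adj v (c t))
    (hpw' : ∀ t, -p' < t → t ≤ 0 → ¬ G.Adj w (c t))
    (hg : Gap G c w x a g) (hf : Free G c v a g) (h2 : 2 ≤ min a g) (hL : max a g ≤ L) :
    p' ≤ p := by
  have := F.k_ge; have hn := F.n_eq; have := F.five_le; have := F.L_ge
  by_contra! hlt
  have hev := hw.gap_even F hg (by omega) hL
  have hal := hw.loc a (by omega) (by omega) hg.left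
  obtain ⟨l₁, hl₁, ml₁, nl₁⟩ := F.cyc.seg 0 (-p) (by omega)
  obtain ⟨l₂, hl₂, ml₂, nl₂⟩ := F.cyc.seg a g (by omega)
  have hvD : ∀ t, min 0 (-p) ≤ t → t ≤ max 0 (-p) → G.Adj v (c t) → t = -p := by
    intro t h3 h4 h5
    by_contra hne
    exact hpv' t (by omega) (by omega) h5
  have hwD : ∀ t, min 0 (-p) ≤ t → t ≤ max 0 (-p) → ¬ G.Adj w (c t) :=
    fun t h3 h4 => hpw' t (by omega) (by omega)
  have P₁ := hl₁.append (.single v) hpv.symm (by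
    simp only [ml₁, List.forall_mem_singleton, and_true]
    exact fun t h3 h4 => link_right hv.off (hvD t h3 h4))
  have P₂ := P₁.append (.single w) hvw (by
    simp only [ml₁, List.forall_mem_singleton, and_true, true_or, List.forall_mem_append]
    exact fun t h3 h4 => .inr (apart_right hw.off (hwD t h3 h4)))
  have P₃ := P₂.append hl₂ hg.left (by
    simp only [ml₁, ml₂, List.forall_mem_singleton, true_and, List.forall_mem_append]
    refine ⟨⟨fun t h3 h4 s h5 h6 => .inr (F.cyc.sep' (by omega) (by omega)),
      fun s h5 h6 => .inr (apart_left hv.off (hf s h5 h6))⟩,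
      fun s h5 h6 => link_left hw.off (hg.left_only s h5 h6)⟩)
  -- The hole has length `p + |a - g| + 5`: odd because `p` and the gap are even, long because `ℓ ≤
  -- p`, yet shorter than `C`. The assumption `p < p'` keeps `w` nonadjacent to the stretch in `D`.
  refine F.no_closure (y := x) P₃ ?_ ?_ ?_ F.x_zero hg.right ?_
  · simp only [List.length_append, List.length_singleton]; push_cast; omega
  · simp only [List.length_append, List.length_singleton]; push_cast; omega
  · simp only [List.length_append, List.length_singleton]; push_cast; omega
  · simp only [ml₁, ml₂, List.forall_mem_singleton, List.forall_mem_append]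
    refine ⟨⟨⟨fun t h3 h4 => ⟨F.x_off t, fun h => .inl ?_⟩, hv.ne_x, fun h => absurd h hv.not_x⟩,
      hw.ne_x, fun h => absurd h hw.not_x⟩, fun t h3 h4 => ⟨F.x_off t, fun h => .inr ?_⟩⟩
    · by_contra hne
      have : t ≠ 0 := by rintro rfl; exact hne rfl
      exact F.x_D t (by omega) (by omega) h
    · rw [hg.right_only t h3 h4 h]

end

/-- `c (-p)` is the first neighbour of `v` in `D`, counted from `c 0`. -/
structure FirstD (G : SimpleGraph V) (ℓ : ℕ) (k : ℤ) (c : ℤ → V) (v : V) (p : ℤ) : Prop where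
  ge : ℓ ≤ p
  le : p ≤ k - ℓ
  even : p % 2 = 0
  adj : G.Adj v (c (-p))
  none : ∀ t, -p < t → t ≤ 0 → ¬ G.Adj v (c t)

theorem FirstD.only {ℓ : ℕ} {k : ℤ} {c : ℤ → V} {v : V} {p : ℤ} (h : FirstD G ℓ k c v p) :
    ∀ t, min 0 (-p) ≤ t → t ≤ max 0 (-p) → G.Adj v (c t) → t = -p := by
  intro t h3 h4 h5
  have := h.ge
  by_contra hne
  exact h.none t (by omega) (by omega) h5

section
variable {ℓ : ℕ} {n k L : ℤ} {c : ℤ → V} {x u v w : V} {p p' : ℤ}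

theorem Frame.x_only (F : Frame G ℓ n k L c x) (hp : FirstD G ℓ k c v p) :
    ∀ t, min 0 (-p) ≤ t → t ≤ max 0 (-p) → G.Adj x (c t) → t = 0 := by
  intro t h3 h4 h5
  have := hp.ge; have := hp.le; have := F.five_le
  by_contra hne
  exact F.x_D t (by omega) (by omega) h5

/-- Each of the two gaps to `x` gives one inequality. -/
theorem Frame.firstD_eq (F : Frame G ℓ n k L c x) (hv : EvenMajor G ℓ n k L c x v)
    (hw : EvenMajor G ℓ n k L c x w) (hvw : G.Adj v w) (hp : FirstD G ℓ k c v p)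
    (hp' : FirstD G ℓ k c w p') {a g a' g' : ℤ}
    (hg : Gap G c v x a g) (hf : Free G c w a g) (h2 : 2 ≤ min a g) (hL : max a g ≤ L)
    (hg' : Gap G c w x a' g') (hf' : Free G c v a' g') (h2' : 2 ≤ min a' g')
    (hL' : max a' g' ≤ L) : p = p' :=
  le_antisymm
    (F.le_of_adj_of_gap hw hv hvw.symm ⟨hp'.ge, hp'.le, hp'.even⟩ hp'.adj hp'.none hp.none
      hg hf h2 hL)
    (F.le_of_adj_of_gap hv hw hvw ⟨hp.ge, hp.le, hp.even⟩ hp.adj hp.none hp'.none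
      hg' hf' h2' hL')

/-- Two gaps between nonadjacent even major vertices `v`, `w`, one odd and in `E`, the other even
and in `D`, form an odd hole. -/
theorem Frame.gap_le_of_even_gap (F : Frame G ℓ n k L c x) (hv : EvenMajor G ℓ n k L c x v)
    (hw : EvenMajor G ℓ n k L c x w) (hne : v ≠ w) (hvw : ¬ G.Adj v w) {m z s r : ℤ}
    (hP : Gap G c v w m z) (h0 : 0 ≤ min m z) (hL : max m z ≤ L)
    (hodd : (max m z - min m z) % 2 = 1) (hT : Gap G c v w s r) (h1 : -k ≤ min s r)
    (h2 : max s r ≤ 0) (hev : (max s r - min s r) % 2 = 0) : max m z - min m z ≤ ℓ - 5 := by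
  have := F.k_ge; have hn := F.n_eq; have := F.five_le; have := F.L_ge
  have := hv.loc m (by omega) (by omega) hP.left
  have := hw.loc z (by omega) (by omega) hP.right
  have := hv.loc s (by omega) (by omega) hT.left
  have := hw.loc r (by omega) (by omega) hT.right
  by_contra hcon
  obtain ⟨l₁, hl₁, ml₁, nl₁⟩ := F.cyc.seg m z (by omega)
  obtain ⟨l₂, hl₂, ml₂, nl₂⟩ := F.cyc.seg r s (by omega)
  have P₁ := hl₁.append (.single w) hP.right.symm (by
    simp only [ml₁, List.forall_mem_singleton, and_true]
    exact fun t h3 h4 => link_right hw.off (hP.right_only t h3 h4))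
  have P₂ := P₁.append hl₂ hT.right (by
    simp only [ml₁, ml₂, List.forall_mem_singleton, true_and, List.forall_mem_append]
    exact ⟨fun t h3 h4 s h5 h6 => .inr (F.cyc.sep (by omega) (by omega)),
      fun s h5 h6 => link_left hw.off (hT.right_only s (by omega) (by omega))⟩)
  -- The length is the sum of the two gap lengths plus four, which is odd. The even gap may be a
  -- single vertex, so the bound on the odd one is `ℓ - 5`.
  refine F.no_closure (y := v) P₂ ?_ ?_ ?_ hP.left hT.left ?_
  · simp only [List.length_append, List.length_singleton]; push_cast; omega
  · simp only [List.length_append, List.length_singleton]; push_cast; omega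
  · simp only [List.length_append, List.length_singleton]; push_cast; omega
  · simp only [ml₁, ml₂, List.forall_mem_singleton, List.forall_mem_append]
    refine ⟨⟨fun t h3 h4 => ⟨hv.off t, fun h => .inl ?_⟩, hne.symm, fun h => absurd h hvw⟩,
      fun t h3 h4 => ⟨hv.off t, fun h => .inr ?_⟩⟩
    · rw [hP.left_only t h3 h4 h]
    · rw [hT.left_only t (by omega) (by omega) h]

/-- If the gap were odd, `x, c 0, …, c (-p), v`, the gap, `w, c a, …, c g` would be a long odd hole
shorter than `C`. As `p < p'`, `w` has no neighbour in the first stretch, and the gap in `D` starts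
at least two steps beyond it. -/
theorem Frame.even_of_gap_beyond (F : Frame G ℓ n k L c x) (hv : EvenMajor G ℓ n k L c x v)
    (hw : EvenMajor G ℓ n k L c x w) (hne : v ≠ w) (hvw : ¬ G.Adj v w)
    (hp : FirstD G ℓ k c v p) (hp' : FirstD G ℓ k c w p') (hlt : p < p') {a g s r : ℤ}
    (hg : Gap G c w x a g) (hf : Free G c v a g) (h2 : 2 ≤ min a g) (hL : max a g ≤ L)
    (hT : Gap G c v w s r) (h1 : -k ≤ min s r) (h3 : max s r ≤ -p - 2) :
    (max s r - min s r) % 2 = 0 := by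
  have := F.k_ge; have hn := F.n_eq; have := F.five_le; have := F.L_ge
  have := hp.ge; have := hp.le; have := hp.even
  have := hv.loc s (by omega) (by omega) hT.left
  have := hw.loc r (by omega) (by omega) hT.right
  have := hw.loc a (by omega) (by omega) hg.left
  have hev := hw.gap_even F hg (by omega) hL
  by_contra hcon
  obtain ⟨l₁, hl₁, ml₁, nl₁⟩ := F.cyc.seg 0 (-p) (by omega)
  obtain ⟨l₂, hl₂, ml₂, nl₂⟩ := F.cyc.seg s r (by omega)
  obtain ⟨l₃, hl₃, ml₃, nl₃⟩ := F.cyc.seg a g (by omega)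
  have P₁ := hl₁.append (.single v) hp.adj.symm (by
    simp only [ml₁, List.forall_mem_singleton, and_true]
    exact fun t h3 h4 => link_right hv.off (hp.only t h3 h4))
  have P₂ := P₁.append hl₂ hT.left (by
    simp only [ml₁, ml₂, List.forall_mem_singleton, true_and, List.forall_mem_append]
    exact ⟨fun t h3 h4 s h5 h6 => .inr (F.cyc.sep (by omega) (by omega)),
      fun s h5 h6 => link_left hv.off (hT.left_only s h5 h6)⟩)
  have P₃ := P₂.append (.single w) hT.right.symm (by
    simp only [ml₁, ml₂, List.forall_mem_singleton, and_true, List.forall_mem_append]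
    exact ⟨⟨fun t h3 h4 => .inr (apart_right hw.off (hp'.none t (by omega) (by omega))),
      .inr ⟨hne, hvw⟩⟩, fun t h3 h4 => link_right hw.off (hT.right_only t h3 h4)⟩)
  have P₄ := P₃.append hl₃ hg.left (by
    simp only [ml₁, ml₂, ml₃, List.forall_mem_singleton, true_and, List.forall_mem_append]
    exact ⟨⟨⟨fun t h3 h4 s h5 h6 => .inr (F.cyc.sep' (by omega) (by omega)),
      fun s h5 h6 => .inr (apart_left hv.off (hf s h5 h6))⟩,
      fun t h3 h4 s h5 h6 => .inr (F.cyc.sep' (by omega) (by omega))⟩,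
      fun s h5 h6 => link_left hw.off (hg.left_only s h5 h6)⟩)
  refine F.no_closure (y := x) P₄ ?_ ?_ ?_ F.x_zero hg.right ?_
  · simp only [List.length_append, List.length_singleton]; push_cast; omega
  · simp only [List.length_append, List.length_singleton]; push_cast; omega
  · simp only [List.length_append, List.length_singleton]; push_cast; omega
  · simp only [ml₁, ml₂, ml₃, List.forall_mem_singleton, List.forall_mem_append]
    refine ⟨⟨⟨⟨fun t h3 h4 => ⟨F.x_off t, fun h => .inl ?_⟩, hv.ne_x,
      fun h => absurd h hv.not_x⟩,
      fun t h3 h4 => ⟨F.x_off t, fun h => absurd h (F.x_D t (by omega) (by omega))⟩⟩,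
      hw.ne_x, fun h => absurd h hw.not_x⟩, fun t h3 h4 => ⟨F.x_off t, fun h => .inr ?_⟩⟩
    · rw [F.x_only hp t h3 h4 h]
    · rw [hg.right_only t h3 h4 h]

/-- Two neighbours of `v` and `w`, respectively, in a range, at minimum distance. -/
theorem exists_gap_in {lo hi a b : ℤ} (ha : lo ≤ a ∧ a ≤ hi) (hb : lo ≤ b ∧ b ≤ hi)
    (hv : G.Adj v (c a)) (hw : G.Adj w (c b)) :
    ∃ s r, Gap G c v w s r ∧ lo ≤ min s r ∧ max s r ≤ hi := by
  classical
  have hex : ∃ d : ℕ, ∃ s r : ℤ, G.Adj v (c s) ∧ G.Adj w (c r) ∧ lo ≤ min s r ∧ max s r ≤ hi ∧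
      d = (s - r).natAbs := ⟨_, a, b, hv, hw, by omega, by omega, rfl⟩
  obtain ⟨s, r, h1, h2, h3, h4, h5⟩ := Nat.find_spec hex
  refine ⟨s, r, ⟨h1, h2, fun t h6 h7 h8 => ?_, fun t h6 h7 h8 => ?_⟩, h3, h4⟩
  · by_contra hne
    exact Nat.find_min hex (m := (t - r).natAbs) (by omega)
      ⟨t, r, h8, h2, by omega, by omega, rfl⟩
  · by_contra hne
    exact Nat.find_min hex (m := (s - t).natAbs) (by omega)
      ⟨s, t, h1, h8, by omega, by omega, rfl⟩

/-- By `Frame.gap_le_of_even_gap` it suffices to find an even gap in `D`. If `p = p'`, it is the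
vertex `c (-p)`. If `c (-p)` is the only neighbour of `v` in `D`, it is the stretch from there to `c
(-p')`. Otherwise `v` also has a neighbour at distance at least two beyond `c (-p)`, and a closest
pair of neighbours there works by `Frame.even_of_gap_beyond`. -/
theorem Frame.gap_le_of_le (F : Frame G ℓ n k L c x) (hv : EvenMajor G ℓ n k L c x v)
    (hw : EvenMajor G ℓ n k L c x w) (hne : v ≠ w) (hvw : ¬ G.Adj v w)
    (hp : FirstD G ℓ k c v p) (hp' : FirstD G ℓ k c w p') (hle : p ≤ p') {m z a g : ℤ}
    (hP : Gap G c v w m z) (h0 : 0 ≤ min m z) (hmL : max m z ≤ L)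
    (hodd : (max m z - min m z) % 2 = 1)
    (hg : Gap G c w x a g) (hf : Free G c v a g) (h2 : 2 ≤ min a g) (hL : max a g ≤ L) :
    max m z - min m z ≤ ℓ - 5 := by
  have := F.k_ge; have hn := F.n_eq; have := F.five_le; have := F.L_ge
  have := hp.ge; have := hp.le; have := hp.even; have := hp'.ge; have := hp'.le
  have := hp'.even
  rcases hle.eq_or_lt with rfl | hlt
  · refine F.gap_le_of_even_gap hv hw hne hvw hP h0 hmL hodd (s := -p) (r := -p)
      ⟨hp.adj, hp'.adj, fun t _ _ _ => by omega, fun t _ _ _ => by omega⟩ (by omega) (by omega)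
      (by omega)
  obtain ⟨q, hq1, hq2, hq3, hq4, hq5⟩ := hv.D_last F
  have hpq : p ≤ q := by
    by_contra hh
    exact hp.none (-q) (by omega) (by omega) hq4
  rcases hpq.eq_or_lt with rfl | hlt'
  · refine F.gap_le_of_even_gap hv hw hne hvw hP h0 hmL hodd (s := -p) (r := -p')
      ⟨hp.adj, hp'.adj, fun t h3 h4 h5 => ?_,
      fun t h3 h4 h5 => hp'.only t (by omega) (by omega) h5⟩ (by omega) (by omega)
      (by omega)
    by_contra hh
    exact hq5 t (by omega) (by omega) h5
  · obtain ⟨s, r, hT, h3, h4⟩ := exists_gap_in (lo := -k) (hi := -p - 2) (a := -q) (b := -p')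
      (by omega) (by omega) hq4 hp'.adj
    exact F.gap_le_of_even_gap hv hw hne hvw hP h0 hmL hodd hT h3 (by omega)
      (F.even_of_gap_beyond hv hw hne hvw hp hp' hlt hg hf h2 hL hT h3 h4)

/-- Odd gaps in `E` between nonadjacent even major vertices are short, if the vertices have
gaps to `x` free of each other. -/
theorem Frame.gap_le (F : Frame G ℓ n k L c x) (hv : EvenMajor G ℓ n k L c x v)
    (hw : EvenMajor G ℓ n k L c x w) (hne : v ≠ w) (hvw : ¬ G.Adj v w) {m z a g a' g' : ℤ}
    (hP : Gap G c v w m z) (h0 : 0 ≤ min m z) (hmL : max m z ≤ L)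
    (hodd : (max m z - min m z) % 2 = 1)
    (hg : Gap G c v x a g) (hf : Free G c w a g) (h2 : 2 ≤ min a g) (hL : max a g ≤ L)
    (hg' : Gap G c w x a' g') (hf' : Free G c v a' g') (h2' : 2 ≤ min a' g')
    (hL' : max a' g' ≤ L) : max m z - min m z ≤ ℓ - 5 := by
  obtain ⟨p, hp1, hp2, hp3, hp4, hp5⟩ := hv.D_first F
  obtain ⟨p', hq1, hq2, hq3, hq4, hq5⟩ := hw.D_first F
  rcases le_total p p' with h | h
  · exact F.gap_le_of_le hv hw hne hvw ⟨hp1, hp2, hp3, hp4, hp5⟩ ⟨hq1, hq2, hq3, hq4, hq5⟩ h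
      hP h0 hmL hodd hg' hf' h2' hL'
  · have := F.gap_le_of_le hw hv hne.symm (fun h => hvw h.symm) ⟨hq1, hq2, hq3, hq4, hq5⟩
      ⟨hp1, hp2, hp3, hp4, hp5⟩ h hP.symm (by omega) (by omega) (by omega) hg hf h2 hL
    omega

/-- If `v`, `u` are adjacent and have gaps of equal parity to `w`, these gaps are short. -/
theorem Frame.gaps_short_of_mid (F : Frame G ℓ n k L c x) (hv : EvenMajor G ℓ n k L c x v)
    (hu : EvenMajor G ℓ n k L c x u) (hw : ∀ t, c t ≠ w) (hvu : G.Adj v u)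
    (hwv : w ≠ v) (hwu : w ≠ u) (hwv' : ¬ G.Adj w v) (hwu' : ¬ G.Adj w u)
    {m a b z : ℤ} (hm : 0 ≤ m) (hma : m ≤ a)
    (hab : a + 2 ≤ b) (hbz : b ≤ z) (hz : z ≤ L) (hg : Gap G c v w m a) (hf : Free G c u m a)
    (hg' : Gap G c u w z b) (hf' : Free G c v z b) (hpar : ((a - m) + (z - b)) % 2 = 0) :
    (a - m) + (z - b) ≤ ℓ - 6 := by
  have := F.k_ge; have hn := F.n_eq; have := F.five_le; have := F.L_ge
  have := hv.loc m (by omega) (by omega) hg.left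
  have := hu.loc z (by omega) (by omega) hg'.left
  by_contra hcon
  obtain ⟨l₁, hl₁, ml₁, nl₁⟩ := F.cyc.seg a m (by omega)
  obtain ⟨l₂, hl₂, ml₂, nl₂⟩ := F.cyc.seg z b (by omega)
  have P₁ := hl₁.append (.single v) hg.left.symm (by
    simp only [ml₁, List.forall_mem_singleton, and_true]
    exact fun t h3 h4 => link_right hv.off (hg.left_only t (by omega) (by omega)))
  have P₂ := P₁.append (.single u) hvu (by
    simp only [ml₁, List.forall_mem_singleton, and_true, true_or, List.forall_mem_append]
    exact fun t h3 h4 => .inr (apart_right hu.off (hf t (by omega) (by omega))))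
  have P₃ := P₂.append hl₂ hg'.left (by
    simp only [ml₁, ml₂, List.forall_mem_singleton, true_and, List.forall_mem_append]
    refine ⟨⟨fun t h3 h4 s h5 h6 => .inr (F.cyc.sep' (by omega) (by omega)),
      fun s h5 h6 => .inr (apart_left hv.off (hf' s h5 h6))⟩,
      fun s h5 h6 => link_left hu.off (hg'.left_only s h5 h6)⟩)
  -- The hole has the odd length `(a - m) + (z - b) + 5`, so it must be shorter than `ℓ`.
  refine F.no_closure (y := w) P₃ ?_ ?_ ?_ hg.right hg'.right ?_
  · simp only [List.length_append, List.length_singleton]; push_cast; omega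
  · simp only [List.length_append, List.length_singleton]; push_cast; omega
  · simp only [List.length_append, List.length_singleton]; push_cast; omega
  · simp only [ml₁, ml₂, List.forall_mem_singleton, List.forall_mem_append]
    refine ⟨⟨⟨fun t h3 h4 => ⟨hw t, fun h => .inl ?_⟩, hwv.symm, fun h => absurd h hwv'⟩,
      hwu.symm, fun h => absurd h hwu'⟩, fun t h3 h4 => ⟨hw t, fun h => .inr ?_⟩⟩
    · rw [hg.right_only t (by omega) (by omega) h]
    · rw [hg'.right_only t h3 h4 h]

/-- Disjoint gaps to `x` from adjacent even major vertices are short. -/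
theorem Frame.gaps_short (F : Frame G ℓ n k L c x) (hv : EvenMajor G ℓ n k L c x v)
    (hu : EvenMajor G ℓ n k L c x u) (hvu : G.Adj v u) {m g h z : ℤ} (hm : 0 ≤ m) (hmg : m ≤ g)
    (hgh : g + 2 ≤ h) (hhz : h ≤ z) (hz : z ≤ L) (hg : Gap G c v x m g) (hf : Free G c u m g)
    (hg' : Gap G c u x z h) (hf' : Free G c v z h) :
    (g - m) + (z - h) ≤ ℓ - 6 := by
  have := hv.gap_even F hg (by omega) (by omega)
  have := hu.gap_even F hg' (by omega) (by omega)
  exact F.gaps_short_of_mid hv hu F.x_off hvu hv.ne_x.symm hu.ne_x.symm hv.not_x hu.not_x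
    hm hmg hgh hhz hz hg hf hg' hf' (by omega)

end

/-! ### Three long pyramids -/

section
variable {ℓ : ℕ} {n k L : ℤ} {c : ℤ → V} {x u v w : V} {p p' : ℤ}

/-- The pyramid with apex `w` and base `c g, c (g + 1), x`. -/
theorem Frame.no_pyramid_at_edge (F : Frame G ℓ n k L c x) (hw : EvenMajor G ℓ n k L c x w)
    {a g b : ℤ} (ha : 0 ≤ a) (hag : a ≤ g - ℓ) (hgb : g + 1 ≤ b) (hb : b ≤ L)
    (hg : Gap G c w x a g) (hg' : Gap G c w x b (g + 1)) : False := by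
  have := F.k_ge; have hn := F.n_eq; have := F.five_le; have := F.L_ge
  obtain ⟨p, hp1, hp2, hp3, hp4, hp5⟩ := hw.D_first F
  have hp : FirstD G ℓ k c w p := ⟨hp1, hp2, hp3, hp4, hp5⟩
  have := hw.loc a (by omega) (by omega) hg.left
  have := hw.loc b (by omega) (by omega) hg'.left
  obtain ⟨l₁, hl₁, ml₁, nl₁⟩ := F.cyc.seg a g (by omega)
  obtain ⟨l₂, hl₂, ml₂, nl₂⟩ := F.cyc.seg (-p) 0 (by omega)
  obtain ⟨l₃, hl₃, ml₃, nl₃⟩ := F.cyc.seg b (g + 1) (by omega)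
  have hx2 : ∀ t, min (-p) 0 ≤ t → t ≤ max (-p) 0 → G.Adj x (c t) → t = 0 :=
    fun t h1 h2 => F.x_only hp t (by omega) (by omega)
  have hw2 : ∀ t, min (-p) 0 ≤ t → t ≤ max (-p) 0 → G.Adj w (c t) → t = -p :=
    fun t h1 h2 => hp.only t (by omega) (by omega)
  have P₁ := (IndPath.single w).append hl₁ hg.left (by
    simp only [ml₁, List.forall_mem_singleton, true_and]
    exact fun t h3 h4 => link_left hw.off (hg.left_only t h3 h4))
  have Q₂ := (IndPath.single w).append hl₂ hp.adj (by
    simp only [ml₂, List.forall_mem_singleton, true_and]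
    exact fun t h3 h4 => link_left hw.off (hw2 t h3 h4))
  have P₂ := Q₂.append (.single x) F.x_zero.symm (by
    simp only [ml₂, List.forall_mem_singleton, and_true, List.forall_mem_append]
    exact ⟨.inr ⟨hw.ne_x, fun h => hw.not_x h.symm⟩,
      fun t h3 h4 => link_right F.x_off (hx2 t h3 h4)⟩)
  have P₃ := (IndPath.single w).append hl₃ hg'.left (by
    simp only [ml₃, List.forall_mem_singleton, true_and]
    exact fun t h3 h4 => link_left hw.off (hg'.left_only t h3 h4))
  -- The long legs run from `w` to `c g` and, through `D`, to `x`; the third may be short.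
  refine F.noPyr (exists_longPyramid P₁ P₂ P₃ (hw.off _) hw.ne_x.symm (hw.off _) hg.right.symm
    (F.cyc.adj_succ g) hg'.right ?_ ?_ ?_ ?_ ?_)
  · simp only [PyramidCross, ml₁, ml₂, List.forall_mem_singleton, List.forall_mem_append, true_or,
      or_true, true_and, and_true, implies_true]
    intro t h3 h4
    refine ⟨fun s h5 h6 => .inr (.inr (.inr (F.cyc.sep (by omega) (by omega)))), .inr (.inr ?_)⟩
    exact link_right F.x_off (hg.right_only t h3 h4)
  · simp only [PyramidCross, ml₁, ml₃, List.forall_mem_singleton, List.forall_mem_append, true_or,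
      or_true, true_and, implies_true]
    intro t h3 h4 s h5 h6
    by_cases hts : t = g ∧ s = g + 1
    · exact .inr (.inr (.inl (by rw [hts.1, hts.2]; simp)))
    · exact .inr (.inr (.inr (F.cyc.sep' (by omega) (by omega))))
  · simp only [PyramidCross, ml₂, ml₃, List.forall_mem_singleton, List.forall_mem_append, true_or,
      or_true, true_and, implies_true]
    refine ⟨fun t h3 h4 s h5 h6 => .inr (.inr (.inr (F.cyc.sep' (by omega) (by omega)))),
      fun s h5 h6 => .inr (.inr ?_)⟩
    exact link_left F.x_off (hg'.right_only s h5 h6)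
  · simp only [List.length_append, List.length_singleton]; omega
  · simp only [List.length_append, List.length_singleton]; omega

/-- The pyramid with apex `c m` and base `c b, c (b + 1), w`. -/
theorem Frame.no_pyramid_at_mark (F : Frame G ℓ n k L c x) (hv : EvenMajor G ℓ n k L c x v)
    (hu : EvenMajor G ℓ n k L c x u) (hw : EvenMajor G ℓ n k L c x w) (hvu : G.Adj v u)
    (hwv : w ≠ v) (hwu : w ≠ u) (hwv' : ¬ G.Adj w v) (hwu' : ¬ G.Adj w u)
    {a m b z : ℤ} (ha : 0 ≤ a) (ham : a ≤ m - ℓ) (hmb : m ≤ b - ℓ) (hbz : b + 1 ≤ z) (hz : z ≤ L)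
    (hvm : G.Adj v (c m)) (hv' : ∀ t, a ≤ t → t ≤ z → G.Adj v (c t) → t = m)
    (huz : G.Adj u (c z)) (hu' : ∀ t, a ≤ t → t ≤ z → G.Adj u (c t) → t = z)
    (hwa : G.Adj w (c a)) (hwb : G.Adj w (c b)) (hwb' : G.Adj w (c (b + 1)))
    (hw' : ∀ t, a ≤ t → t ≤ z → G.Adj w (c t) → t = a ∨ t = b ∨ t = b + 1) : False := by
  have := F.k_ge; have hn := F.n_eq; have := F.five_le; have := F.L_ge
  obtain ⟨l₁, hl₁, ml₁, nl₁⟩ := F.cyc.seg m b (by omega)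
  obtain ⟨l₂, hl₂, ml₂, nl₂⟩ := F.cyc.seg m a (by omega)
  obtain ⟨l₃, hl₃, ml₃, nl₃⟩ := F.cyc.seg z (b + 1) (by omega)
  have hmw : ¬ G.Adj w (c m) := fun h => by
    have := hw' m (by omega) (by omega) h; omega
  have P₂ := hl₂.append (.single w) hwa.symm (by
    simp only [ml₂, List.forall_mem_singleton, and_true]
    exact fun t h3 h4 => link_right hw.off fun h => by
      have := hw' t (by omega) (by omega) h; omega)
  have Q₃ := (IndPath.single v).append (.single u) hvu (by simp)
  have R₃ := Q₃.append hl₃ huz (by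
    simp only [ml₃, List.forall_mem_singleton, true_and, List.forall_mem_append]
    exact ⟨fun t h3 h4 => .inr (apart_left hv.off fun h => by
      have := hv' t (by omega) (by omega) h; omega),
      fun t h3 h4 => link_left hu.off (hu' t (by omega) (by omega))⟩)
  have P₃ := (IndPath.single (c m)).append R₃ hvm.symm (by
    simp only [ml₃, List.forall_mem_singleton, true_and, true_or, List.forall_mem_append]
    exact ⟨.inr (apart_right hu.off fun h => by
      have := hu' m (by omega) (by omega) h; omega),
      fun t h3 h4 => .inr (F.cyc.sep' (by omega) (by omega))⟩)
  -- The two long legs run along `C` from `c m` in opposite directions, to `c b` and via `c a` to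
  -- `w`; the third takes the edge `vu` and returns along `C` from `c z`.
  refine F.noPyr (exists_longPyramid hl₁ P₂ P₃ (F.cyc.sep (by omega) (by omega)).1
    (hw.off m).symm (F.cyc.sep (by omega) (by omega)).1 hwb.symm
    (F.cyc.adj_succ b) hwb' ?_ ?_ ?_ ?_ ?_)
  · simp only [PyramidCross, ml₁, ml₂, List.forall_mem_singleton, List.forall_mem_append,
      and_true]
    intro t h3 h4
    refine ⟨fun s h5 h6 => ?_, .inr (.inr ?_)⟩
    · by_cases h1 : t = m
      · left; rw [h1]
      · by_cases h2 : s = m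
        · right; left; rw [h2]
        · exact .inr (.inr (.inr (F.cyc.sep (by omega) (by omega))))
    · exact link_right hw.off fun h => by
        have := hw' t (by omega) (by omega) h; omega
  · simp only [PyramidCross, ml₁, ml₃, List.forall_mem_singleton, List.forall_mem_append, true_or,
      or_true, true_and]
    intro t h3 h4
    refine ⟨⟨?_, .inr (.inr (.inr (apart_right hu.off fun h => ?_)))⟩, fun s h5 h6 => ?_⟩
    · by_cases h1 : G.Adj v (c t)
      · left; rw [hv' t (by omega) (by omega) h1]
      · exact .inr (.inr (.inr (apart_right hv.off h1)))
    · have := hu' t (by omega) (by omega) h; omega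
    · by_cases hts : t = b ∧ s = b + 1
      · exact .inr (.inr (.inl (by rw [hts.1, hts.2]; simp)))
      · exact .inr (.inr (.inr (F.cyc.sep' (by omega) (by omega))))
  · simp only [PyramidCross, ml₂, ml₃, List.forall_mem_singleton, List.forall_mem_append, true_or,
      or_true, true_and]
    refine ⟨fun t h3 h4 => ⟨⟨?_, .inr (.inr (.inr (apart_right hu.off fun h => ?_)))⟩,
      fun s h5 h6 => .inr (.inr (.inr (F.cyc.sep' (by omega) (by omega))))⟩,
      ⟨.inr (.inr (.inr ⟨hwv, hwv'⟩)), .inr (.inr (.inr ⟨hwu, hwu'⟩))⟩,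
      fun s h5 h6 => .inr (.inr (link_left hw.off fun h => ?_))⟩
    · by_cases h1 : G.Adj v (c t)
      · left; rw [hv' t (by omega) (by omega) h1]
      · exact .inr (.inr (.inr (apart_right hv.off h1)))
    · have := hu' t (by omega) (by omega) h; omega
    · have := hw' s (by omega) (by omega) h; omega
  · omega
  · simp only [List.length_append, List.length_singleton]; omega

/-- The pyramid with apex `v` and base `c b, c (b + 1), w`. -/
theorem Frame.no_pyramid_at_vertex (F : Frame G ℓ n k L c x) (hv : EvenMajor G ℓ n k L c x v)
    (hu : EvenMajor G ℓ n k L c x u) (hw : EvenMajor G ℓ n k L c x w) (hvu : G.Adj v u)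
    (hwv : w ≠ v) (hwu : w ≠ u) (hwv' : ¬ G.Adj w v) (hwu' : ¬ G.Adj w u)
    {a e m b z : ℤ} (ha : 0 ≤ a) (hae : a ≤ e) (hem : e ≤ m - 2) (hmb : m ≤ b - ℓ)
    (hbz : b + 1 ≤ z - ℓ) (hz : z ≤ L) (hve : G.Adj v (c e))
    (hve' : ∀ t, a ≤ t → t ≤ e → G.Adj v (c t) → t = e)
    (hvm : G.Adj v (c m)) (hv' : ∀ t, m ≤ t → t ≤ z → G.Adj v (c t) → t = m)
    (huz : G.Adj u (c z)) (hu' : ∀ t, a ≤ t → t ≤ z → G.Adj u (c t) → t = z)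
    (hwa : G.Adj w (c a)) (hwb : G.Adj w (c b)) (hwb' : G.Adj w (c (b + 1)))
    (hw' : ∀ t, a ≤ t → t ≤ z → G.Adj w (c t) → t = a ∨ t = b ∨ t = b + 1) : False := by
  have := F.k_ge; have hn := F.n_eq; have := F.five_le; have := F.L_ge
  obtain ⟨l₁, hl₁, ml₁, nl₁⟩ := F.cyc.seg m b (by omega)
  obtain ⟨l₂, hl₂, ml₂, nl₂⟩ := F.cyc.seg e a (by omega)
  obtain ⟨l₃, hl₃, ml₃, nl₃⟩ := F.cyc.seg z (b + 1) (by omega)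
  have P₁ := (IndPath.single v).append hl₁ hvm (by
    simp only [ml₁, List.forall_mem_singleton, true_and]
    exact fun t h3 h4 => link_left hv.off (hv' t (by omega) (by omega)))
  have Q₂ := hl₂.append (.single w) hwa.symm (by
    simp only [ml₂, List.forall_mem_singleton, and_true]
    exact fun t h3 h4 => link_right hw.off fun h => by
      have := hw' t (by omega) (by omega) h; omega)
  have P₂ := (IndPath.single v).append Q₂ hve (by
    simp only [ml₂, List.forall_mem_singleton, true_and, List.forall_mem_append]
    exact ⟨fun t h3 h4 => link_left hv.off (hve' t (by omega) (by omega)),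
      .inr ⟨hwv.symm, fun h => hwv' h.symm⟩⟩)
  have Q₃ := (IndPath.single v).append (.single u) hvu (by simp)
  have P₃ := Q₃.append hl₃ huz (by
    simp only [ml₃, List.forall_mem_singleton, true_and, List.forall_mem_append]
    exact ⟨fun t h3 h4 => .inr (apart_left hv.off fun h => by
      have := hv' t (by omega) (by omega) h; omega),
      fun t h3 h4 => link_left hu.off (hu' t (by omega) (by omega))⟩)
  -- The leg through `c e` and `c a` may be short, so it is listed last. As `e ≤ m - 2`, it has no
  -- edge to the leg starting at `c m`, apart from those at the apex.
  refine F.noPyr (exists_longPyramid P₁ P₃ P₂ (hv.off _) (hv.off _) hwv (F.cyc.adj_succ b)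
    hwb.symm hwb'.symm ?_ ?_ ?_ ?_ ?_)
  · simp only [PyramidCross, ml₁, ml₃, List.forall_mem_singleton, List.forall_mem_append, true_or,
      or_true, true_and, and_true, implies_true]
    intro t h3 h4
    refine ⟨.inr (.inr (.inr (apart_right hu.off fun h => ?_))), fun s h5 h6 => ?_⟩
    · have := hu' t (by omega) (by omega) h; omega
    · by_cases hts : t = b ∧ s = b + 1
      · exact .inr (.inr (.inl (by rw [hts.1, hts.2]; simp)))
      · exact .inr (.inr (.inr (F.cyc.sep' (by omega) (by omega))))
  · simp only [PyramidCross, ml₁, ml₂, List.forall_mem_singleton, List.forall_mem_append, true_or,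
      or_true, true_and, and_true, implies_true]
    intro t h3 h4
    refine ⟨fun s h5 h6 => .inr (.inr (.inr (F.cyc.sep (by omega) (by omega)))), .inr (.inr ?_)⟩
    exact link_right hw.off fun h => by
        have := hw' t (by omega) (by omega) h; omega
  · simp only [PyramidCross, ml₂, ml₃, List.forall_mem_singleton, List.forall_mem_append, true_or,
      or_true, true_and, and_true, implies_true]
    refine ⟨⟨fun s h5 h6 => .inr (.inr (.inr (apart_left hu.off fun h => ?_))),
      .inr (.inr (.inr ⟨hwu.symm, fun h => hwu' h.symm⟩))⟩, fun t h3 h4 =>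
      ⟨fun s h5 h6 => .inr (.inr (.inr (F.cyc.sep (by omega) (by omega)))), .inr (.inr ?_)⟩⟩
    · have := hu' s (by omega) (by omega) h; omega
    · exact link_right hw.off fun h => by
        have := hw' t (by omega) (by omega) h; omega
  · simp only [List.length_append, List.length_singleton]; omega
  · simp only [List.length_append, List.length_singleton]; omega

end

/-! ### Vertices leaving and entering along `E`, and the extremal choice -/

section
variable {ℓ : ℕ} {n k L : ℤ} {c : ℤ → V} {x u v w : V}

/-- `f` has no neighbour from `c h` up to the next neighbour of `x` (exclusive), and its last
neighbour before `c h` in `E` is `c m`, with `m` odd. -/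
structure OddBefore (G : SimpleGraph V) (ℓ : ℕ) (n k L : ℤ) (c : ℤ → V) (x f : V) (h m : ℤ) :
    Prop where
  em : EvenMajor G ℓ n k L c x f
  not_enter : ∀ t, h ≤ t → t ≤ L → G.Adj f (c t) → ∃ s, h < s ∧ s ≤ t ∧ G.Adj x (c s)
  nonneg : 0 ≤ m
  lt : m < h
  adj : G.Adj f (c m)
  odd : m % 2 = 1
  none : ∀ t, m < t → t < h → ¬ G.Adj f (c t)

/-- `c z` is the first neighbour of `u` after the neighbour `c h` of `x`, with `h` even, there is
no further neighbour of `x` in between, the last neighbour of `u` before `c h` is even if it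
exists, and comes before that of all vertices whose last neighbour before `c h` is odd. -/
structure Entry (G : SimpleGraph V) (ℓ : ℕ) (n k L : ℤ) (c : ℤ → V) (x u : V) (h z : ℤ) :
    Prop where
  em : EvenMajor G ℓ n k L c x u
  x_h : G.Adj x (c h)
  even : h % 2 = 0
  le : h ≤ z
  z_lt : z < L
  adj : G.Adj u (c z)
  free : ∀ t, h ≤ t → t < z → ¬ G.Adj u (c t)
  no_x : ∀ t, h < t → t ≤ z → ¬ G.Adj x (c t)
  last_even : ∀ t, 0 ≤ t → t < h → G.Adj u (c t) → (∀ s, t < s → s < h → ¬ G.Adj u (c s)) →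
    t % 2 = 0
  before : ∀ f m, OddBefore G ℓ n k L c x f h m → ∀ t, 0 ≤ t → t < h → G.Adj u (c t) → t < m

/-- The first neighbour of `w` after a long stretch of nonneighbours is even, if the last one before
is even or does not exist. -/
theorem Frame.next_even (F : Frame G ℓ n k L c x) (hw : EvenMajor G ℓ n k L c x w)
    {lo hi : ℤ} (hlo : 0 ≤ hi) (hi' : hi ≤ L) (hlen : ℓ - 3 ≤ hi - lo)
    (hfree : ∀ t, 0 ≤ t → lo ≤ t → t ≤ hi → ¬ G.Adj w (c t))
    (hlast : ∀ t, 0 ≤ t → t < lo → G.Adj w (c t) →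
      (∀ s, t < s → s ≤ hi → ¬ G.Adj w (c s)) → t % 2 = 0) :
    ∃ t, hi < t ∧ t ≤ L - ℓ ∧ t % 2 = 0 ∧ G.Adj w (c t) ∧ ∀ s, hi < s → s < t → ¬ G.Adj w (c s) := by
  have := F.k_ge; have hn := F.n_eq; have := F.five_le; have := F.L_ge
  have hlast' : ∀ t, 0 ≤ t → t ≤ hi → G.Adj w (c t) →
      (∀ s, t < s → s ≤ hi → ¬ G.Adj w (c s)) → t < lo ∧ t % 2 = 0 := by
    intro t h1 h2 h3 h4
    have : t < lo := by
      by_contra hh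
      exact hfree t h1 (by omega) h2 h3
    exact ⟨this, hlast t h1 this h3 h4⟩
  obtain ⟨b, hb1, hb2, hb3, hb4, hb5⟩ := hw.E_last F
  -- The last neighbour in `E` is odd, whereas a last neighbour up to `hi` would be even.
  have hbhi : hi < b := by
    by_contra hh
    have := hlast' b (by omega) (by omega) hb4 (fun s h1 h2 => hb5 s h1 (by omega))
    omega
  obtain ⟨t, h1, h2, h3, h4⟩ := exists_first (P := fun t => G.Adj w (c t)) (a := hi + 1) (b := b)
    ⟨b, by omega, le_rfl, hb4⟩
  refine ⟨t, by omega, by omega, ?_, h3, fun s hs => h4 s (by omega)⟩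
  by_cases hex : ∃ s, 0 ≤ s ∧ s ≤ hi ∧ G.Adj w (c s)
  · obtain ⟨s, s1, s2, s3, s4⟩ := exists_last hex
    obtain ⟨s5, s6⟩ := hlast' s s1 s2 s3 s4
    by_contra hodd
    have := F.close_of_odd hw.off (a := s) (b := t) (by omega) (by omega) s3 h3
      (fun r r1 r2 => by
        rcases le_or_gt r hi with h | h
        · exact s4 r r1 h
        · exact h4 r (by omega) r2) (by omega)
    omega
  · push Not at hex
    obtain ⟨a, ha1, ha2, ha3, ha4, ha5⟩ := hw.E_first F
    have : hi < a := by
      by_contra hh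
      exact hex a (by omega) (by omega) ha4
    have : a ≤ t := by
      by_contra hh
      exact ha5 t (by omega) (by omega) h3
    have : t ≤ a := by
      by_contra hh
      exact h4 a (by omega) (by omega) ha4
    omega

/-- A vertex whose last neighbour before a long stretch of nonneighbours is even, or does not
exist, enters again at an even neighbour of `x`. -/
theorem Frame.exists_entry (F : Frame G ℓ n k L c x) (hw : EvenMajor G ℓ n k L c x w)
    {lo hi h : ℤ} (hh : 0 ≤ h) (hhi : h ≤ hi) (hi' : hi ≤ L) (hloh : lo ≤ h)
    (hlen : ℓ - 3 ≤ hi - lo) (hx : G.Adj x (c h))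
    (hfree : ∀ t, 0 ≤ t → lo ≤ t → t ≤ hi → ¬ G.Adj w (c t))
    (hlast : ∀ t, 0 ≤ t → t < lo → G.Adj w (c t) →
      (∀ s, t < s → s ≤ hi → ¬ G.Adj w (c s)) → t % 2 = 0)
    (hN : ∀ f m', OddBefore G ℓ n k L c x f h m' → lo ≤ m') :
    ∃ h' z, h ≤ h' ∧ hi < z ∧ Entry G ℓ n k L c x w h' z := by
  have := F.k_ge; have hn := F.n_eq; have := F.five_le; have := F.L_ge
  obtain ⟨z, hz1, hz2, hz3, hz4, hz5⟩ := F.next_even hw (by omega) hi' hlen hfree hlast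
  -- The stretch from this last neighbour of `x` to `c z` is an `(x, w)`-gap, so `h'` is even like
  -- `z`.
  obtain ⟨h', h1, h2, h3, h4⟩ := exists_last (P := fun t => G.Adj x (c t)) (a := h) (b := z)
    ⟨h, le_rfl, by omega, hx⟩
  have hnone : ∀ t, lo ≤ t → 0 ≤ t → t < z → ¬ G.Adj w (c t) := by
    intro t t1 t2 t3
    rcases le_or_gt t hi with h | h
    · exact hfree t t2 t1 h
    · exact hz5 t h t3
  have hgap : Gap G c w x z h' := ⟨hz4, h3, fun t t1 t2 t3 => by
    by_contra hne
    exact hnone t (by omega) (by omega) (by omega) t3, fun t t1 t2 t3 => by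
    by_contra hne
    exact h4 t (by omega) (by omega) t3⟩
  have hev := hw.gap_even F hgap (by omega) (by omega)
  refine ⟨h', z, h1, hz1, hw, h3, by omega, h2, by omega, hz4,
    fun t t1 t2 => hnone t (by omega) (by omega) t2, h4, ?_, ?_⟩
  · intro t t1 t2 t3 t4
    have : t < lo := by
      by_contra hh
      exact hnone t (by omega) (by omega) (by omega) t3
    refine hlast t t1 this t3 fun s s1 s2 => ?_
    rcases lt_or_ge s h' with h | h
    · exact t4 s s1 h
    · exact hnone s (by omega) (by omega) (by omega)
  · intro f m' hf t t1 t2 t3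
    have htlo : t < lo := by
      by_contra hh
      exact hnone t (by omega) (by omega) (by omega) t3
    by_contra hle
    -- A vertex that leaves before `c h'` at `m' < lo` also leaves before the earlier `c h`, which
    -- `hN` excludes.
    have : OddBefore G ℓ n k L c x f h m' := by
      refine ⟨hf.em, fun s s1 s2 s3 => ?_, hf.nonneg, by omega, hf.adj, hf.odd,
        fun s s1 s2 => hf.none s s1 (by omega)⟩
      rcases lt_or_ge s h' with h5 | h5
      · exact absurd s3 (hf.none s (by omega) h5)
      · rcases h1.eq_or_lt with rfl | h6
        · exact hf.not_enter s s1 s2 s3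
        · exact ⟨h', h6, h5, h3⟩
    have := hN f m' this
    omega

/-- In `c m, …, c z`, let only `c m` be a neighbour of `v` and only `c z` of `u`, and let `c g` and
`c h` be the first and last neighbours of `x`, where `m` is odd and `h` even. An even major vertex
with no neighbours near `c m`, `c z` and `c g`, and not adjacent to the first neighbour of `u` in
`D`, has no neighbours in `c m, …, c z`. -/
theorem Frame.no_mark_between (F : Frame G ℓ n k L c x) (hv : EvenMajor G ℓ n k L c x v)
    (hu : EvenMajor G ℓ n k L c x u) (hw : EvenMajor G ℓ n k L c x w) {m g h z p : ℤ}
    (hp : FirstD G ℓ k c u p) (hm : 0 ≤ m) (hmg : m ≤ g) (hgh : g < h) (hhz : h ≤ z) (hz : z < L)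
    (mo : m % 2 = 1) (ho : h % 2 = 0)
    (hvm : G.Adj v (c m)) (hv' : ∀ t, m < t → t ≤ z → ¬ G.Adj v (c t))
    (huz : G.Adj u (c z)) (hu' : ∀ t, m ≤ t → t < z → ¬ G.Adj u (c t))
    (hu'' : ∀ t, 0 ≤ t → t < m → G.Adj u (c t) → (∀ s, t < s → s < m → ¬ G.Adj u (c s)) →
      t % 2 = 0)
    (hxg : G.Adj x (c g)) (hxg' : ∀ t, m ≤ t → t < g → ¬ G.Adj x (c t))
    (hxh : G.Adj x (c h)) (hxh' : ∀ t, h < t → t ≤ z → ¬ G.Adj x (c t))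
    (w₁ : ∀ t, m - ℓ < t → t < m + ℓ → ¬ G.Adj w (c t))
    (w₂ : ∀ t, z - ℓ < t → t ≤ z → ¬ G.Adj w (c t))
    (w₃ : ∀ t, g - ℓ < t → t ≤ g → ¬ G.Adj w (c t))
    (w₄ : ¬ G.Adj w (c (-p))) : ∀ t, m ≤ t → t ≤ z → ¬ G.Adj w (c t) := by
  have := F.k_ge; have hn := F.n_eq; have := F.five_le; have := F.L_ge
  have hmℓ := hv.loc m (by omega) (by omega) hvm
  have hzℓ := hu.loc z (by omega) (by omega) huz
  intro t₀ t1 t2 t3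
  obtain ⟨wb, b1, b2, b3, b4⟩ := exists_first (P := fun t => G.Adj w (c t)) ⟨t₀, t1, t2, t3⟩
  obtain ⟨wl, l1, l2, l3, l4⟩ := exists_last (P := fun t => G.Adj w (c t)) ⟨t₀, t1, t2, t3⟩
  have hb : m + ℓ ≤ wb := by
    by_contra hh; exact w₁ wb (by omega) (by omega) b3
  have hl : wl ≤ z - ℓ := by
    by_contra hh; exact w₂ wl (by omega) (by omega) l3
  have hbl : wb ≤ wl := by
    by_contra hh; exact b4 wl (by omega) (by omega) l3
  have hwv : w ≠ v := by rintro rfl; exact w₁ m (by omega) (by omega) hvm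
  have hwu : w ≠ u := by rintro rfl; exact w₂ z (by omega) (by omega) huz
  have hvo : ∀ t, m ≤ t → t ≤ z → G.Adj v (c t) → t = m := fun t h1 h2 h3 => by
    by_contra hh; exact hv' t (by omega) h2 h3
  have huo : ∀ t, m ≤ t → t ≤ z → G.Adj u (c t) → t = z := fun t h1 h2 h3 => by
    by_contra hh; exact hu' t (by omega) (by omega) h3
  have huv : u ≠ v := by
    rintro rfl; exact hu' m (by omega) (by omega) hvm
  have G₁ : Gap G c v x m g := ⟨hvm, hxg, fun t h1 h2 => hvo t (by omega) (by omega),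
    fun t h1 h2 h3 => by by_contra hh; exact hxg' t (by omega) (by omega) h3⟩
  have G₂ : Gap G c u x z h := ⟨huz, hxh, fun t h1 h2 => huo t (by omega) (by omega),
    fun t h1 h2 h3 => by by_contra hh; exact hxh' t (by omega) (by omega) h3⟩
  have G₃ : Gap G c v u m z := ⟨hvm, huz, fun t h1 h2 => hvo t (by omega) (by omega),
    fun t h1 h2 => huo t (by omega) (by omega)⟩
  have f₁ : Free G c u m g := fun t h1 h2 => hu' t (by omega) (by omega)
  have f₂ : Free G c v z h := fun t h1 h2 => hv' t (by omega) (by omega)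
  have e₁ := hv.gap_even F G₁ (by omega) (by omega)
  have e₂ := hu.gap_even F G₂ (by omega) (by omega)
  -- Here `m` is odd and `z` even, and the neighbours of `w` show `z - m ≥ 2 * ℓ`: too long for an
  -- odd gap between nonadjacent vertices.
  have hvu : G.Adj v u := by
    by_contra hvu
    have := F.gap_le hv hu huv.symm hvu G₃ (by omega) (by omega) (by omega) G₁ f₁ (by omega)
      (by omega) G₂ f₂ (by omega) (by omega)
    omega
  obtain ⟨r, r1, r2, r3, r4, r5⟩ := hv.D_first F
  obtain ⟨s, s1, s2, s3, s4, s5⟩ := hw.D_first F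
  have hr : FirstD G ℓ k c v r := ⟨r1, r2, r3, r4, r5⟩
  have hs : FirstD G ℓ k c w s := ⟨s1, s2, s3, s4, s5⟩
  -- Now `v` and `u` have the same first neighbour in `D`, which `w` misses. So adjacency of `w` to
  -- either is refuted whenever `Frame.firstD_eq` applies.
  have hrp : r = p := F.firstD_eq hv hu hvu hr hp G₁ f₁ (by omega) (by omega) G₂ f₂ (by omega)
    (by omega)
  have hsp : s ≠ p := by rintro rfl; exact w₄ s4
  have Gvb : Gap G c v w m wb := ⟨hvm, b3, fun t h1 h2 => hvo t (by omega) (by omega),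
    fun t h1 h2 h3 => by by_contra hh; exact b4 t (by omega) (by omega) h3⟩
  have Gul : Gap G c u w z wl := ⟨huz, l3, fun t h1 h2 => huo t (by omega) (by omega),
    fun t h1 h2 h3 => by by_contra hh; exact l4 t (by omega) (by omega) h3⟩
  -- If `c g` and `c h` are consecutive, neighbours of `w` on both sides give the pyramid at that
  -- edge. With neighbours on one side only, parity of the gap to `x` yields an overlong odd gap
  -- from `w` to `u` or to `v`.
  rcases (show g + 1 ≤ h by omega).eq_or_lt with rfl | hgh'
  · by_cases c₁ : wb ≤ g
    · by_cases c₂ : g + 1 ≤ wl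
      · obtain ⟨a, a1, a2, a3, a4⟩ := exists_last (P := fun t => G.Adj w (c t)) ⟨wb, b1, c₁, b3⟩
        obtain ⟨b, d1, d2, d3, d4⟩ := exists_first (P := fun t => G.Adj w (c t)) ⟨wl, c₂, l2, l3⟩
        refine F.no_pyramid_at_edge hw (a := a) (g := g) (b := b) (by omega) ?_ d1 (by omega)
          ⟨a3, hxg, fun t h1 h2 h3 => ?_, fun t h1 h2 h3 => ?_⟩
          ⟨d3, hxh, fun t h1 h2 h3 => ?_, fun t h1 h2 h3 => ?_⟩
        · by_contra hh; exact w₃ a (by omega) (by omega) a3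
        · by_contra hh; exact a4 t (by omega) (by omega) h3
        · by_contra hh; exact hxg' t (by omega) (by omega) h3
        · by_contra hh; exact d4 t (by omega) (by omega) h3
        · by_contra hh; exact hxh' t (by omega) (by omega) h3
      · have Gw : Gap G c w x wl g := ⟨l3, hxg,
          fun t h1 h2 h3 => by by_contra hh; exact l4 t (by omega) (by omega) h3,
          fun t h1 h2 h3 => by by_contra hh; exact hxg' t (by omega) (by omega) h3⟩
        have e₃ := hw.gap_even F Gw (by omega) (by omega)
        have fu : Free G c u wl g := fun t h1 h2 => hu' t (by omega) (by omega)
        have fw : Free G c w z (g + 1) := fun t h1 h2 => l4 t (by omega) (by omega)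
        by_cases huw : G.Adj u w
        · exact hsp (F.firstD_eq hu hw huw hp hs G₂ fw (by omega) (by omega) Gw fu (by omega)
            (by omega)).symm
        · have := F.gap_le hu hw hwu.symm huw Gul (by omega) (by omega) (by omega) G₂ fw
            (by omega) (by omega) Gw fu (by omega) (by omega)
          omega
    · have Gw : Gap G c w x wb (g + 1) := ⟨b3, hxh,
        fun t h1 h2 h3 => by by_contra hh; exact b4 t (by omega) (by omega) h3,
        fun t h1 h2 h3 => by by_contra hh; exact hxh' t (by omega) (by omega) h3⟩
      have e₃ := hw.gap_even F Gw (by omega) (by omega)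
      have fv : Free G c v wb (g + 1) := fun t h1 h2 => hv' t (by omega) (by omega)
      have fw : Free G c w m g := fun t h1 h2 => b4 t (by omega) (by omega)
      by_cases hvw : G.Adj v w
      · exact hsp ((F.firstD_eq hv hw hvw hr hs G₁ fw (by omega) (by omega) Gw fv (by omega)
          (by omega)).symm.trans hrp)
      · have := F.gap_le hv hw hwv.symm hvw Gvb (by omega) (by omega) (by omega) G₁ fw
          (by omega) (by omega) Gw fv (by omega) (by omega)
        omega
  -- The gaps from `x` to `v` and to `u` are short, so the neighbours of `w`, at least `ℓ` away from
  -- `c m` and `c z`, all lie strictly between `c g` and `c h`.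
  · have hshort := F.gaps_short hv hu hvu hm hmg (by omega) hhz hz.le G₁ f₁ G₂ f₂
    obtain ⟨xl, xl1, xl2, xl3, xl4⟩ := exists_last (P := fun t => G.Adj x (c t)) (a := g) (b := wb)
      ⟨g, le_rfl, by omega, hxg⟩
    obtain ⟨xr, xr1, xr2, xr3, xr4⟩ := exists_first (P := fun t => G.Adj x (c t)) (a := wl) (b := h)
      ⟨h, by omega, by omega, hxh⟩
    have Gr : Gap G c w x wl xr := ⟨l3, xr3,
      fun t h1 h2 h3 => by by_contra hh; exact l4 t (by omega) (by omega) h3,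
      fun t h1 h2 h3 => by by_contra hh; exact xr4 t (by omega) (by omega) h3⟩
    have Gl : Gap G c w x wb xl := ⟨b3, xl3,
      fun t h1 h2 h3 => by by_contra hh; exact b4 t (by omega) (by omega) h3,
      fun t h1 h2 h3 => by by_contra hh; exact xl4 t (by omega) (by omega) h3⟩
    have fr : Free G c v wl xr := fun t h1 h2 => hv' t (by omega) (by omega)
    have fl : Free G c u wb xl := fun t h1 h2 => hu' t (by omega) (by omega)
    have f₃ : Free G c w m g := fun t h1 h2 => b4 t (by omega) (by omega)
    have f₄ : Free G c w z h := fun t h1 h2 => l4 t (by omega) (by omega)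
    have hvw : ¬ G.Adj v w := fun hvw => hsp ((F.firstD_eq hv hw hvw hr hs G₁ f₃ (by omega)
      (by omega) Gr fr (by omega) (by omega)).symm.trans hrp)
    have huw : ¬ G.Adj u w := fun huw => hsp (F.firstD_eq hu hw huw hp hs G₂ f₄ (by omega)
      (by omega) Gl fl (by omega) (by omega)).symm
    have hwb : wb % 2 = 1 := by
      by_contra hh
      have := F.gap_le hv hw hwv.symm hvw Gvb (by omega) (by omega) (by omega) G₁ f₃
          (by omega) (by omega) Gr fr (by omega) (by omega)
      omega
    have hwl : wl % 2 = 0 := by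
      by_contra hh
      have := F.gap_le hu hw hwu.symm huw Gul (by omega) (by omega) (by omega) G₂ f₄
          (by omega) (by omega) Gl fl (by omega) (by omega)
      omega
    -- If `wb + 2 ≤ wl`, then `w, v, u` and the two stretches form a forbidden hole. So `w` has
    -- exactly two neighbours here, and they are consecutive.
    rcases (show wb + 1 ≤ wl by omega).eq_or_lt with rfl | hlt
    swap
    · have := F.gaps_short_of_mid hv hu hw.off hvu hwv hwu (fun h => hvw h.symm)
        (fun h => huw h.symm) hm (a := wb) (b := wl) (by omega) (by omega) (by omega) (by omega)
        Gvb (fun t h1 h2 => hu' t (by omega) (by omega)) Gul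
        (fun t h1 h2 => hv' t (by omega) (by omega)) (by omega)
      omega
    -- The first neighbour of `w` in `E` has even index, while `wb` is odd.
    have hex : ∃ t, 0 ≤ t ∧ t ≤ m ∧ G.Adj w (c t) := by
      by_contra! hno
      obtain ⟨a, ha1, ha2, ha3, ha4, ha5⟩ := hw.E_first F
      have h1 : a ≤ wb := by
        by_contra hh; exact ha5 wb (by omega) (by omega) b3
      have h2 : wb ≤ a := by
        by_contra hh
        rcases le_or_gt a m with h | h
        · exact hno a (by omega) h ha4
        · exact b4 a (by omega) (by omega) ha4
      omega
    obtain ⟨a, a1, a2, a3, a4⟩ := exists_last hex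
    have ham : a ≤ m - ℓ := by
      by_contra hh; exact w₁ a (by omega) (by omega) a3
    have haw : ∀ t, a < t → t < wb → ¬ G.Adj w (c t) := by
      intro t h1 h2
      rcases le_or_gt t m with h | h
      · exact a4 t h1 h
      · exact b4 t (by omega) h2
    have hao : a % 2 = 1 := by
      by_contra hh
      have := F.close_of_odd hw.off (a := a) (b := wb) (by omega) (by omega) a3 b3 haw (by omega)
      omega
    -- The last neighbour of `u` before `c m` would be even, making an overlong odd gap to `c wb`.
    have hua : ∀ t, a ≤ t → t ≤ z → G.Adj u (c t) → t = z := by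
      intro t h1 h2 h3
      by_contra hne
      have htm : t < m := by
        by_contra hh; exact hu' t (by omega) (by omega) h3
      obtain ⟨e, e1, e2, e3, e4⟩ := exists_last (P := fun t => G.Adj u (c t)) (a := a) (b := m - 1)
        ⟨t, h1, by omega, h3⟩
      have := hu'' e (by omega) (by omega) e3 (fun s hs hs' => e4 s hs (by omega))
      have Gue : Gap G c u w e wb := ⟨e3, b3,
        fun t h1 h2 h3 => by
          by_contra hh
          rcases lt_or_ge t m with h | h
          · exact e4 t (by omega) (by omega) h3
          · exact hu' t h (by omega) h3,
        fun t h1 h2 h3 => by by_contra hh; exact haw t (by omega) (by omega) h3⟩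
      have := F.gap_le hu hw hwu.symm huw Gue (by omega) (by omega) (by omega) G₂ f₄
          (by omega) (by omega) Gl fl (by omega) (by omega)
      omega
    have hwo : ∀ t, a ≤ t → t ≤ z → G.Adj w (c t) → t = a ∨ t = wb ∨ t = wb + 1 := by
      intro t h1 h2 h3
      by_contra hne
      rcases lt_or_ge t wb with h | h
      · exact haw t (by omega) h h3
      · exact l4 t (by omega) h2 h3
    -- The position of `e` selects the pyramid: apex `c m` if `e = m`, apex `v` if `e ≤ m - 2`. If
    -- `e = m - 1`, then `e` is even and `a` odd, again an overlong odd gap.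
    obtain ⟨e, d1, d2, d3, d4⟩ := exists_first (P := fun t => G.Adj v (c t)) (a := a) (b := m)
        ⟨m, by omega, le_rfl, hvm⟩
    by_cases he : e = m
    · subst he
      refine F.no_pyramid_at_mark hv hu hw hvu hwv hwu (fun h => hvw h.symm)
        (fun h => huw h.symm) (a := a) (m := e) (b := wb) (z := z) a1 ham (by omega) (by omega)
        (by omega) hvm (fun t h1 h2 h3 => ?_) huz hua a3 b3 l3 hwo
      by_contra hne
      rcases lt_or_ge t e with h | h
      · exact d4 t h1 h h3
      · exact hv' t (by omega) h2 h3
    by_cases he' : e = m - 1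
    · have Gve : Gap G c v w e a := ⟨d3, a3,
        fun t h1 h2 h3 => by by_contra hh; exact d4 t (by omega) (by omega) h3,
        fun t h1 h2 h3 => by by_contra hh; exact haw t (by omega) (by omega) h3⟩
      have := F.gap_le hv hw hwv.symm hvw Gve (by omega) (by omega) (by omega) G₁ f₃
          (by omega) (by omega) Gr fr (by omega) (by omega)
      omega
    · refine F.no_pyramid_at_vertex hv hu hw hvu hwv hwu (fun h => hvw h.symm)
        (fun h => huw h.symm) (a := a) (e := e) (m := m) (b := wb) (z := z) a1 d1 (by omega)
        (by omega) (by omega) (by omega) d3 (fun t h1 h2 h3 => ?_) hvm hvo huz hua a3 b3 l3 hwo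
      by_contra hne
      exact d4 t h1 (by omega) h3

/-- All even major vertices have a neighbour in one of four short intervals, or a common
neighbour. -/
theorem Frame.exists_positions (F : Frame G ℓ n k L c x) :
    ∃ a m z g p : ℤ, ∀ w, EvenMajor G ℓ n k L c x w →
      (∃ t, G.Adj w (c t) ∧ ((a - ℓ < t ∧ t ≤ a) ∨ (m - ℓ < t ∧ t < m + ℓ) ∨
        (z - ℓ < t ∧ t ≤ z) ∨ (g - ℓ < t ∧ t ≤ g))) ∨ G.Adj w (c (-p)) := by
  have := F.k_ge; have hn := F.n_eq; have := F.five_le; have := F.L_ge; have := F.L_odd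
  -- The index `0` qualifies, since no position in `E` precedes it.
  obtain ⟨h₀, h1, h2, ⟨h3, h4, h5⟩, h6⟩ := exists_last (a := 0) (b := L - 1)
    (P := fun t => G.Adj x (c t) ∧ t % 2 = 0 ∧ ∀ f m, ¬ OddBefore G ℓ n k L c x f t m)
    ⟨0, le_rfl, by omega, F.x_zero, rfl, fun f m hf => by
      have := hf.nonneg; have := hf.lt; omega⟩
  obtain ⟨h₁, i1, i2, i3, i4⟩ := exists_first (P := fun t => G.Adj x (c t)) (a := h₀ + 1) (b := L)
    ⟨L, by omega, le_rfl, F.x_L⟩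
  have hdesc : ∀ f m h, h₁ ≤ h → OddBefore G ℓ n k L c x f h m → m < h₀ → False := by
    intro f m h hh hf hm
    refine h5 f m ⟨hf.em, fun t t1 t2 t3 => ?_, hf.nonneg, hm, hf.adj, hf.odd,
      fun t t1 t2 => hf.none t t1 (by omega)⟩
    rcases lt_or_ge t h₁ with h7 | h7
    · exact absurd t3 (hf.none t (by omega) (by omega))
    · exact ⟨h₁, by omega, h7, i3⟩
  -- If `h₁` were even, some vertex would leave before it at an odd `m`: for `m < h₀` this
  -- contradicts the choice of `h₀`, and otherwise `c m, …, c h₁` is an odd gap to `x`.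
  have hodd : h₁ % 2 = 1 := by
    by_contra hev
    refine h6 h₁ (by omega) (by omega) ⟨i3, by omega, fun f m hf => ?_⟩
    rcases lt_or_ge m h₀ with hm | hm
    · exact hdesc f m h₁ le_rfl hf hm
    · have hlt := hf.lt
      have ho := hf.odd
      have hgap : Gap G c f x m h₁ := ⟨hf.adj, i3, fun t t1 t2 t3 => by
        by_contra hne
        by_cases ht : t = h₁
        · subst ht
          obtain ⟨s, s1, s2, s3⟩ := hf.not_enter t le_rfl i2 t3
          omega
        · exact hf.none t (by omega) (by omega) t3, fun t t1 t2 t3 => by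
        by_contra hne
        exact i4 t (by omega) (by omega) t3⟩
      have := hf.em.gap_even F hgap (by omega) (by omega)
      omega
  have hclose := F.close_of_odd F.x_off (a := h₀) (b := h₁) (by omega) (by omega) h3 i3
    (fun t t1 t2 => i4 t (by omega) t2) (by omega)
  by_cases hE : ∃ h, h₀ + 1 ≤ h ∧ h ≤ L ∧ ∃ u z, Entry G ℓ n k L c x u h z
  swap
  -- One interval ending at `h₁` suffices here; the other positions are fillers. It reaches back
  -- past `h₀` because `h₁ - h₀ ≤ ℓ - 3`, so a vertex missing it would produce an entry.
  · refine ⟨h₁, h₁, h₁, h₁, 0, fun w hw => .inl ?_⟩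
    by_contra! hno
    have hno' : ∀ t, 0 ≤ t → h₁ - ℓ + 1 ≤ t → t ≤ h₁ → ¬ G.Adj w (c t) := fun t _ t1 t2 t3 => by
      have := (hno t t3).1; omega
    obtain ⟨h', z, z1, z2, z3⟩ := F.exists_entry hw (lo := h₁ - ℓ + 1) (hi := h₁) (h := h₁)
      (by omega) le_rfl i2 (by omega) (by omega) i3 hno'
      (fun t t1 t2 t3 t4 => by
        by_contra hev
        exact h5 w t ⟨hw, fun s s1 s2 s3 => by
          by_cases hs : s ≤ h₁
          · exact absurd s3 (t4 s (by omega) hs)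
          · exact ⟨h₁, by omega, by omega, i3⟩, t1, by omega, t3, by omega,
          fun s s1 s2 => t4 s s1 (by omega)⟩)
      (fun f m hf => by
        by_contra hh
        exact hdesc f m h₁ le_rfl hf (by omega))
    exact hE ⟨h', by omega, by have := z3.le; have := z3.z_lt; omega, w, z, z3⟩
  obtain ⟨h, e1, e2, hE', e3⟩ := exists_last hE
  obtain ⟨z, e4, e5, ⟨u, hu⟩, e6⟩ := exists_last (a := h) (b := L)
    (P := fun z => ∃ u, Entry G ℓ n k L c x u h z) (by
      obtain ⟨u, z, hu⟩ := hE'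
      exact ⟨z, hu.le, hu.z_lt.le, u, hu⟩)
  have hzL := hu.z_lt
  have hho := hu.even
  -- By the choice of `h₀`, some vertex leaves before the later even neighbour `c h` of `x` at an
  -- odd position.
  have hNe : ∃ m, 0 ≤ m ∧ m ≤ h ∧ ∃ f, OddBefore G ℓ n k L c x f h m := by
    by_contra! hno
    exact h6 h (by omega) (by omega) ⟨hu.x_h, hu.even, fun f m hf =>
      hno m hf.nonneg hf.lt.le f hf⟩
  obtain ⟨m, m1, m2, ⟨v, hv⟩, m3⟩ := exists_first hNe
  have hmh := hv.lt
  have hmo := hv.odd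
  obtain ⟨g, g1, g2, g3, g4⟩ := exists_first (P := fun t => G.Adj x (c t)) (a := m) (b := h)
    ⟨h, m2, le_rfl, hu.x_h⟩
  have hv' : ∀ t, m < t → t ≤ z → ¬ G.Adj v (c t) := by
    intro t t1 t2 t3
    rcases lt_or_ge t h with hh | hh
    · exact hv.none t t1 hh t3
    · obtain ⟨s, s1, s2, s3⟩ := hv.not_enter t hh (by omega) t3
      exact hu.no_x s s1 (by omega) s3
  have hu' : ∀ t, m ≤ t → t < z → ¬ G.Adj u (c t) := by
    intro t t1 t2 t3
    rcases lt_or_ge t h with hh | hh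
    · have := hu.before v m hv t (by omega) hh t3
      omega
    · exact hu.free t hh t2 t3
  have hgh : g < h := by
    rcases g2.eq_or_lt with rfl | hlt
    · have hgap : Gap G c v x m g := ⟨hv.adj, g3, fun t t1 t2 t3 => by
        by_contra hne
        exact hv' t (by omega) (by omega) t3, fun t t1 t2 t3 => by
        by_contra hne
        exact g4 t (by omega) (by omega) t3⟩
      have := hv.em.gap_even F hgap (by omega) (by omega)
      omega
    · exact hlt
  obtain ⟨p, p1, p2, p3, p4, p5⟩ := hu.em.D_first F
  refine ⟨h₁, m, z, g, p, fun w hw => ?_⟩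
  by_contra! hno
  obtain ⟨hno, hwp⟩ := hno
  have w₁ : ∀ t, m - ℓ < t → t < m + ℓ → ¬ G.Adj w (c t) := fun t t1 t2 t3 => by
    have := (hno t t3).2.1; omega
  have w₂ : ∀ t, z - ℓ < t → t ≤ z → ¬ G.Adj w (c t) := fun t t1 t2 t3 => by
    have := (hno t t3).2.2.1; omega
  have w₃ : ∀ t, g - ℓ < t → t ≤ g → ¬ G.Adj w (c t) := fun t t1 t2 t3 => by
    have := (hno t t3).2.2.2; omega
  have hfree := F.no_mark_between hv.em hu.em hw ⟨p1, p2, p3, p4, p5⟩ m1 g1 hgh e4 hzL hmo hho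
    hv.adj hv' hu.adj hu'
    (fun t t1 t2 t3 t4 => hu.last_even t t1 (by omega) t3 fun s s1 s2 => by
      rcases lt_or_ge s m with hs | hs
      · exact t4 s s1 hs
      · exact hu' s hs (by omega)) g3 g4 hu.x_h hu.no_x w₁ w₂ w₃ hwp
  have hfree' : ∀ t, m - ℓ + 1 ≤ t → t ≤ z → ¬ G.Adj w (c t) := fun t t1 t2 => by
    rcases lt_or_ge t m with ht | ht
    · exact w₁ t (by omega) (by omega)
    · exact hfree t ht t2
  obtain ⟨h', z', z1, z2, z3⟩ := F.exists_entry hw (lo := m - ℓ + 1) (hi := z) (h := h)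
    (by omega) e4 e5 (by omega) (by omega) hu.x_h (fun t _ t1 t2 => hfree' t t1 t2)
    (fun t t1 t2 t3 t4 => by
      by_contra hev
      -- Suppose the last neighbour `c t` of `w` is odd. If `w` enters before the next neighbour of
      -- `x`, it does so at an even `s`, and `t`, `s` are consecutive at a large odd distance.
      -- Otherwise `w` leaves before `c h` at `t < m`, against the choice of `m`.
      by_cases hent : ∃ s, h ≤ s ∧ s ≤ L ∧ G.Adj w (c s) ∧ ∀ r, h < r → r ≤ s → ¬ G.Adj x (c r)
      · obtain ⟨s, s1, s2, ⟨s3, s4⟩, s5⟩ := exists_first hent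
        have hsf : ∀ r, h ≤ r → r < s → ¬ G.Adj w (c r) := fun r r1 r2 r3 =>
          s5 r r1 r2 ⟨r3, fun q q1 q2 => s4 q q1 (by omega)⟩
        have hgap : Gap G c w x s h := ⟨s3, hu.x_h, fun r r1 r2 r3 => by
          by_contra hne
          exact hsf r (by omega) (by omega) r3, fun r r1 r2 r3 => by
          by_contra hne
          exact s4 r (by omega) (by omega) r3⟩
        have := hw.gap_even F hgap (by omega) (by omega)
        have := F.close_of_odd hw.off (a := t) (b := s) (by omega) (by omega) t3 s3
          (fun r r1 r2 => by
            rcases le_or_gt r z with hr | hr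
            · exact t4 r r1 hr
            · exact hsf r (by omega) r2) (by omega)
        omega
      · push Not at hent
        refine m3 t t1 (by omega) ⟨w, hw, fun s s1 s2 s3 => ?_, t1, by omega, t3, by omega,
          fun s s1 s2 => t4 s s1 (by omega)⟩
        exact hent s s1 s2 s3)
    (fun f m' hf => by
      by_contra hh
      exact m3 m' hf.nonneg (by omega) ⟨f, hf⟩)
  rcases z1.eq_or_lt with rfl | hlt
  · exact e6 z' z2 z3.z_lt.le ⟨w, z3⟩
  · exact e3 h' hlt (by have := z3.le; have := z3.z_lt; omega) ⟨w, z', z3⟩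

end

/-! ### From the hole in the graph to integer coordinates -/

/-- `c` parametrises the hole `C`. -/
structure Coord {u : V} (C : G.Walk u u) (c : ℤ → V) : Prop where
  hole : IsHole C
  cyc : IsCyc G C.length c
  mem : ∀ w, w ∈ C.support ↔ ∃ t, w = c t

theorem exists_coord {u : V} {C : G.Walk u u} (hC : IsHole C) : ∃ c, Coord C c := by
  obtain ⟨hcyc, hind, hlen⟩ := hC
  let n : ℤ := C.length
  have hn : 0 < n := by simp only [n]; omega
  let c : ℤ → V := fun i => C.getVert (i % n).toNat
  have hnat : ∀ r : ℕ, r ≤ C.length → C.getVert r = c r := by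
    intro r hr
    simp only [c]
    rcases hr.eq_or_lt with rfl | hr
    · simp [n]
    · rw [Int.emod_eq_of_lt (by omega) (by simp only [n]; omega)]; simp
  have hper : ∀ i, c (i + n) = c i := fun i => by simp [c]
  have hinj : ∀ i j, c i = c j → n ∣ i - j := by
    intro i j h
    have h1 := Int.emod_nonneg i hn.ne'
    have h2 := Int.emod_lt_of_pos i hn
    have h3 := Int.emod_nonneg j hn.ne'
    have h4 := Int.emod_lt_of_pos j hn
    have := hcyc.getVert_injOn' (x₁ := (i % n).toNat) (x₂ := (j % n).toNat)
      (by simp only [Set.mem_ofPred_eq, n] at *; omega)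
      (by simp only [Set.mem_ofPred_eq, n] at *; omega) h
    exact Int.ModEq.dvd (show j % n = i % n by omega)
  have hred : ∀ i : ℤ, ∃ r : ℕ, r < C.length ∧ n ∣ i - r ∧ c i = C.getVert r := by
    intro i
    have h1 := Int.emod_nonneg i hn.ne'
    have h2 := Int.emod_lt_of_pos i hn
    refine ⟨(i % n).toNat, by simp only [n] at *; omega, ?_, rfl⟩
    rw [Int.toNat_of_nonneg h1]
    exact Int.dvd_self_sub_emod
  have hsucc : ∀ i, G.Adj (c i) (c (i + 1)) := by
    intro i
    obtain ⟨r, hr, ⟨q, hq⟩, h1⟩ := hred i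
    have h2 : c (i + 1) = C.getVert (r + 1) := by
      rw [hnat _ (by omega)]
      have : ∀ q : ℤ, c ((r + 1 : ℕ) + n * q) = c ((r + 1 : ℕ)) := fun q => by simp [c]
      rw [← this q]; congr 1; push_cast; linarith
    rw [h1, h2]
    exact C.adj_getVert_succ hr
  refine ⟨c, ⟨hcyc, hind, hlen⟩, ⟨by omega, hper, hinj, ?_⟩, ?_⟩
  · intro i j
    constructor
    · intro h
      have hmem : ∀ i, c i ∈ C.toSubgraph.verts := fun i => by
        simp [c, Walk.getVert_mem_support]
      have := hind (hmem i) (hmem j) h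
      rw [Walk.toSubgraph_adj_iff] at this
      obtain ⟨r, hr, hrn⟩ := this
      rw [hnat r hrn.le, hnat (r + 1) hrn, Sym2.eq_iff] at hr
      rcases hr with ⟨h1, h2⟩ | ⟨h1, h2⟩
      · right
        obtain ⟨q, hq⟩ := hinj _ _ h1
        obtain ⟨q', hq'⟩ := hinj _ _ h2
        refine ⟨q' - q, ?_⟩
        push_cast at hq'
        linear_combination hq' - hq
      · left
        obtain ⟨q, hq⟩ := hinj _ _ h1
        obtain ⟨q', hq'⟩ := hinj _ _ h2
        refine ⟨q - q', ?_⟩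
        push_cast at hq'
        linear_combination hq - hq'
    · have hq : ∀ i q : ℤ, c (i + n * q) = c i := fun i q => by simp [c]
      rintro (⟨q, h⟩ | ⟨q, h⟩)
      · have := (hsucc j).symm
        rw [← hq (j + 1) q] at this
        convert this using 2
        linarith
      · have := hsucc i
        rw [← hq (i + 1) (-q)] at this
        convert this using 2
        linarith
  · intro w
    rw [Walk.mem_support_iff_exists_getVert]
    constructor
    · rintro ⟨r, rfl, hr⟩; exact ⟨r, hnat r hr⟩
    · rintro ⟨t, rfl⟩
      obtain ⟨r, hr, -, h⟩ := hred t
      exact ⟨r, h.symm, hr.le⟩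

section
variable {u : V} {C : G.Walk u u} {c : ℤ → V}

theorem Coord.neg (h : Coord C c) : Coord C (fun t => c (-t)) :=
  ⟨h.hole, h.cyc.neg, fun w => by
    rw [h.mem]
    exact ⟨fun ⟨t, ht⟩ => ⟨-t, by simpa using ht⟩, fun ⟨t, ht⟩ => ⟨-t, ht⟩⟩⟩

theorem Coord.shift (h : Coord C c) (s : ℤ) : Coord C (fun t => c (s + t)) :=
  ⟨h.hole, h.cyc.shift s, fun w => by
    rw [h.mem]
    exact ⟨fun ⟨t, ht⟩ => ⟨t - s, by simpa using ht⟩, fun ⟨t, ht⟩ => ⟨s + t, ht⟩⟩⟩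

theorem Coord.mem_support (h : Coord C c) (t : ℤ) : c t ∈ C.support := (h.mem _).2 ⟨t, rfl⟩

theorem Coord.toSubgraph_adj (h : Coord C c) {v w : V} (hv : v ∈ C.support) (hw : w ∈ C.support)
    (hvw : G.Adj v w) : C.toSubgraph.Adj v w :=
  h.hole.2.1 (by simpa using hv) (by simpa using hw) hvw

theorem Coord.isPathOf (h : Coord C c) {a b : V} {P : G.Walk a b} (hP : P.IsPath)
    (hs : ∀ w ∈ P.support, w ∈ C.support) : IsPathOf C P := by
  refine ⟨hP, fun w hw => by simpa using hs w (by simpa using hw), fun v w hvw => ?_⟩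
  have h1 := P.toSubgraph.edge_vert hvw
  have h2 := P.toSubgraph.edge_vert hvw.symm
  exact h.toSubgraph_adj (hs _ (by simpa using h1)) (hs _ (by simpa using h2)) hvw.adj_sub

/-- Consecutive vertices of the cycle form a path of it. -/
theorem Coord.exists_walk (h : Coord C c) (i j : ℤ) (hij : i ≤ j) (hn : j - i ≤ C.length - 2) :
    ∃ P : G.Walk (c i) (c j), IsPathOf C P ∧ IsInducedPath P ∧ (P.length : ℤ) = j - i ∧
      ∀ w, w ∈ P.support ↔ ∃ t, i ≤ t ∧ t ≤ j ∧ w = c t := by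
  obtain ⟨l, hl, ml, nl⟩ := h.cyc.seg_up i j hij hn
  obtain ⟨P, rfl, hP⟩ := hl.exists_walk
  refine ⟨P, h.isPathOf hP.1 fun w hw => ?_, hP, ?_, ml⟩
  · obtain ⟨t, -, -, rfl⟩ := (ml w).1 hw
    exact h.mem_support t
  · rw [Walk.length_support] at nl; push_cast at nl; omega

theorem Coord.exists_pathOf (h : Coord C c) (i j : ℤ) (hij : i ≤ j)
    (hn : j - i ≤ C.length - 2) : ∃ P : PathOf C,
      (∀ w, w ∈ P.walk.support → ∃ t, i ≤ t ∧ t ≤ j ∧ w = c t) ∧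
      ∀ t, i < t → t < j → c t ∈ interior P.walk := by
  obtain ⟨P, h1, h2, h3, h4⟩ := h.exists_walk i j hij hn
  refine ⟨⟨_, _, P, h1⟩, fun w hw => (h4 w).1 hw, fun t h5 h6 => ⟨(h4 _).2 ⟨t, by omega, by omega,
    rfl⟩, fun e => ?_, fun e => ?_⟩⟩
  · have := h.cyc.eq_cases e (by omega) (by omega); omega
  · have := h.cyc.eq_cases e (by omega) (by omega); omega

/-- A path of the cycle runs along it in one of the two directions. -/
theorem Coord.exists_direction (h : Coord C c) {a b : V} (P : G.Walk a b) (hP : P.IsPath)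
    (hs : ∀ w ∈ P.support, w ∈ C.support) :
    ∃ s ε : ℤ, (ε = 1 ∨ ε = -1) ∧ ∀ j : ℕ, j ≤ P.length → P.getVert j = c (s + ε * j) := by
  have hnb : ∀ i j, G.Adj (c i) (c j) → c i = c (j + 1) ∨ c i = c (j - 1) := by
    intro i j hij
    rcases (h.cyc.adj i j).1 hij with hd | hd
    · left; exact h.cyc.eq_of_dvd (by convert hd using 1; ring)
    · right; exact h.cyc.eq_of_dvd (by convert hd using 1; ring)
  induction P with
  | nil =>
    rename_i a
    obtain ⟨t, ht⟩ := (h.mem a).1 (hs a (by simp))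
    exact ⟨t, 1, .inl rfl, fun j hj => by simp at hj; subst hj; simpa using ht⟩
  | @cons a d b had P ih =>
    rw [Walk.cons_isPath_iff] at hP
    obtain ⟨s, ε, hε, hj⟩ := ih hP.1 fun w hw => hs w (by simp [hw])
    obtain ⟨t, rfl⟩ := (h.mem a).1 (hs a (by simp))
    have hd : d = c s := by simpa using hj 0 (by simp)
    subst hd
    have key : ∃ ε' : ℤ, (ε' = 1 ∨ ε' = -1) ∧ c t = c (s - ε') ∧
        ∀ j : ℕ, j ≤ P.length → P.getVert j = c (s + ε' * j) := by
      by_cases hl : P.length = 0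
      · rcases hnb t s had with h1 | h1
        · exact ⟨-1, .inr rfl, by simpa using h1, fun j hj => by
            have : j = 0 := by omega
            subst this; simp⟩
        · exact ⟨1, .inl rfl, h1, fun j hj => by
            have : j = 0 := by omega
            subst this; simp⟩
      · refine ⟨ε, hε, ?_, hj⟩
        have h1 := hj 1 (by omega)
        have h2 : c t ≠ c (s + ε) := by
          intro e
          apply hP.2
          rw [e, show s + ε = s + ε * (1 : ℕ) by simp, ← h1]
          exact P.getVert_mem_support 1
        rcases hε with rfl | rfl <;> rcases hnb t s had with h3 | h3
        · exact absurd h3 h2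
        · exact h3
        · simpa using h3
        · exact absurd h3 h2
    obtain ⟨ε', hε', h1, h2⟩ := key
    refine ⟨s - ε', ε', hε', fun j hj => ?_⟩
    cases j with
    | zero => simpa using h1
    | succ j =>
      rw [Walk.getVert_cons_succ, h2 j (by simpa using hj)]
      congr 1; push_cast; ring

theorem Coord.dist_le (h : Coord C c) (i : ℤ) (m : ℕ) :
    C.toSubgraph.spanningCoe.dist (c i) (c (i + m)) ≤ m := by
  have : ∃ W : C.toSubgraph.spanningCoe.Walk (c i) (c (i + m)), W.length = m := by
    induction m with
    | zero => exact ⟨Walk.nil.copy rfl (by simp), by simp⟩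
    | succ m ih =>
      obtain ⟨W, hW⟩ := ih
      have hadj : C.toSubgraph.spanningCoe.Adj (c (i + m)) (c (i + (m + 1 : ℕ))) := by
        rw [Subgraph.spanningCoe_adj]
        refine h.toSubgraph_adj (h.mem_support _) (h.mem_support _) ?_
        have := h.cyc.adj_succ (i + m)
        convert this using 2
        push_cast; ring
      exact ⟨W.concat hadj, by simp [hW]⟩
  obtain ⟨W, hW⟩ := this
  exact (SimpleGraph.dist_le W).trans hW.le

/-- Remoteness excludes small distances in `C`, so upper bounds on the distance are all that is
needed. -/
theorem Coord.dist_lt (h : Coord C c) {ℓ : ℕ} {i j : ℤ} (h1 : i - j < ℓ) (h2 : j - i < ℓ) :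
    C.toSubgraph.spanningCoe.dist (c i) (c j) < ℓ := by
  rcases le_total i j with hij | hij
  · obtain ⟨m, hm⟩ := Int.eq_ofNat_of_zero_le (sub_nonneg.2 hij)
    have := h.dist_le i m
    rw [show i + (m : ℤ) = j by omega] at this
    omega
  · obtain ⟨m, hm⟩ := Int.eq_ofNat_of_zero_le (sub_nonneg.2 hij)
    have := h.dist_le j m
    rw [show j + (m : ℤ) = i by omega, SimpleGraph.dist_comm] at this
    omega

theorem Coord.exists_reduce (h : Coord C c) (m t : ℤ) :
    ∃ s, m - C.length < s ∧ s ≤ m ∧ c s = c t := by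
  have h4 := h.cyc.four_le
  refine ⟨m - (m - t) % C.length, ?_, ?_, h.cyc.eq_of_dvd ?_⟩
  · have := Int.emod_lt_of_pos (m - t) (show (0 : ℤ) < C.length by omega); omega
  · have := Int.emod_nonneg (m - t) (show (C.length : ℤ) ≠ 0 by omega); omega
  · rw [show m - (m - t) % C.length - t = m - t - (m - t) % C.length by ring]
    exact Int.dvd_self_sub_emod

/-- Adding `x` and `v` at the ends keeps the path induced, so it is an `(x, v)`-gap; even length
means an odd number of vertices. -/
theorem Coord.even_of_gap (h : Coord C c) {x v a b : V} {l : List V} (hl : IndPath G a b l)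
    (hlC : ∀ y ∈ l, y ∈ C.support) (hx : x ∉ C.support) (hv : v ∉ C.support) (hxv : v ≠ x)
    (hnx : ¬ G.Adj x v) (hxa : G.Adj x a) (hvb : G.Adj v b) (hx' : ∀ y ∈ l, y ≠ a → ¬ G.Adj x y)
    (hv' : ∀ y ∈ l, y ≠ b → ¬ G.Adj v y) (hpar : HasEvenParity C x v) : l.length % 2 = 1 := by
  have hlx : ∀ y ∈ l, y ≠ x := fun y hy e => hx (e ▸ hlC y hy)
  have hlv : ∀ y ∈ l, y ≠ v := fun y hy e => hv (e ▸ hlC y hy)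
  have P₁ : IndPath G x b (x :: l) := .cons hxa hl fun y hy hne => ⟨(hlx y hy).symm, hx' y hy hne⟩
  have P₂ := P₁.append (.single v) hvb.symm (by
    simp only [List.forall_mem_singleton, List.forall_mem_cons, and_true]
    refine ⟨.inr ⟨hxv.symm, hnx⟩, fun y hy => ?_⟩
    by_cases hyb : y = b
    · exact .inl hyb
    · exact .inr ⟨hlv y hy, fun h => hv' y hy hyb h.symm⟩)
  obtain ⟨R, hR, hRI⟩ := P₂.exists_walk
  obtain ⟨P, rfl, hPI⟩ := hl.exists_walk
  have := hpar a b P ⟨h.isPathOf hPI.1 hlC, R, hRI, by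
    ext w
    simp only [interior, hR, Set.mem_ofPred_eq, List.cons_append, List.mem_cons, List.mem_append,
      List.not_mem_nil, or_false]
    constructor
    · rintro ⟨h1, h2, h3⟩; tauto
    · intro hw; exact ⟨.inr (.inl hw), hlx w hw, hlv w hw⟩⟩
  rw [Walk.length_support]
  rw [Nat.even_iff] at this
  omega

end

section
variable {ℓ : ℕ} {u : V} {C : G.Walk u u} {c : ℤ → V} {x : V} {d₁ d₂ : V} {D : G.Walk d₁ d₂}

/-- Coordinates in which the path `D` of the cycle runs backwards from `c 0`. -/
theorem exists_coord_along (hC : IsHole C) (hD : IsPathOf C D) :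
    ∃ c, Coord C c ∧ ∀ j : ℕ, j ≤ D.length → D.getVert j = c (-j) := by
  obtain ⟨c, hc⟩ := exists_coord hC
  obtain ⟨s, ε, hε, hj⟩ := hc.exists_direction D hD.1 fun w hw => by
    have := hD.2.1 (show w ∈ D.toSubgraph.verts by simpa using hw)
    simpa using this
  rcases hε with rfl | rfl
  · exact ⟨fun t => c (s + -t), (hc.shift s).neg, fun j h => by simpa using hj j h⟩
  · exact ⟨fun t => c (s + t), hc.shift s, fun j h => by simpa using hj j h⟩

/-- The three-vertex path centred at `c t` misses some neighbour of `v`, whose index is then reduced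
to a prescribed period. -/
theorem Coord.exists_of_isMajor (h : Coord C c) {v : V} (hv : IsMajor C v) (m t : ℤ) :
    ∃ s, m - C.length < s ∧ s ≤ m ∧ G.Adj v (c s) ∧ s - t ≠ 0 ∧ s - t - 1 ≠ 0 ∧ s - t + 1 ≠ 0 ∧
      ¬ ((C.length : ℤ) ∣ s - t) ∧ ¬ ((C.length : ℤ) ∣ s - t - 1) ∧
      ¬ ((C.length : ℤ) ∣ s - t + 1) := by
  have h4 := h.cyc.four_le
  obtain ⟨P, h1, h2, h3, h5⟩ := h.exists_walk (t - 1) (t + 1) (by omega) (by omega)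
  by_contra! hno
  refine hv.2 ⟨_, _, P, h1, by omega, fun w hw hvw => ?_⟩
  obtain ⟨s, rfl⟩ := (h.mem w).1 hw
  obtain ⟨s', s1, s2, s3⟩ := h.exists_reduce m s
  rw [← s3] at hvw ⊢
  rw [h5]
  by_cases e1 : (C.length : ℤ) ∣ s' - t
  · exact ⟨t, by omega, by omega, h.cyc.eq_of_dvd e1⟩
  by_cases e2 : (C.length : ℤ) ∣ s' - t - 1
  · exact ⟨t + 1, by omega, by omega, h.cyc.eq_of_dvd (by convert e2 using 1; ring)⟩
  by_cases e3 : (C.length : ℤ) ∣ s' - t + 1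
  · exact ⟨t - 1, by omega, by omega, h.cyc.eq_of_dvd (by convert e3 using 1; ring)⟩
  have z1 : s' - t ≠ 0 := fun e => e1 (e ▸ dvd_zero _)
  have z2 : s' - t - 1 ≠ 0 := fun e => e2 (e ▸ dvd_zero _)
  have z3 : s' - t + 1 ≠ 0 := fun e => e3 (e ▸ dvd_zero _)
  exact absurd (hno s' s1 s2 hvw z1 z2 z3 e1 e2) e3

theorem Coord.frame (h : Coord C c) (hℓ : 5 ≤ ℓ) (hG : IsCandidate ℓ G)
    (hC : IsShortestLongOddHole ℓ C) (hD : IsRemoteBase ℓ C x D)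
    (hDc : ∀ j : ℕ, j ≤ D.length → D.getVert j = c (-j)) :
    Frame G ℓ C.length D.length (C.length - D.length) c x := by
  obtain ⟨⟨hx, ⟨hDC, ha, hb, hint⟩, hmax⟩, hlen, hrem⟩ := hD
  obtain ⟨⟨hole, hCℓ, hCodd⟩, hmin⟩ := hC
  rw [Nat.odd_iff] at hCodd
  have h4 := h.cyc.four_le
  have hkn : D.length < C.length := by
    by_contra hh
    have h1 := hDc C.length (by omega)
    have h2 := hDc 0 (by omega)
    have h3 : c (-(C.length : ℤ)) = c 0 := h.cyc.eq_of_dvd ⟨-1, by ring⟩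
    rw [h3] at h1
    simp only [Nat.cast_zero, neg_zero] at h2
    have := hDC.1.getVert_injOn (by simp only [Set.mem_ofPred_eq]; omega)
      (by simp) (h1.trans h2.symm)
    omega
  have h0 : G.Adj x (c 0) := by
    have := hDc 0 (by omega)
    simp only [Walk.getVert_zero, Nat.cast_zero, neg_zero] at this
    rwa [← this]
  have hd₂ : d₂ = c (-(D.length : ℤ)) := by simpa using hDc D.length le_rfl
  have hLk : c (C.length - D.length) = c (-(D.length : ℤ)) :=
    h.cyc.eq_of_dvd ⟨1, by ring⟩
  have hL : G.Adj x (c (C.length - D.length)) := by rwa [hLk, ← hd₂]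
  have hxD : ∀ t : ℤ, -(D.length : ℤ) < t → t < 0 → ¬ G.Adj x (c t) := by
    intro t h1 h2
    obtain ⟨j, rfl⟩ : ∃ j : ℕ, t = -j := ⟨(-t).toNat, by omega⟩
    rw [← hDc j (by omega)]
    refine hint _ ⟨D.getVert_mem_support j, fun e => ?_, fun e => ?_⟩
    · have := hDC.1.getVert_injOn (x₁ := j) (x₂ := 0) (by simp only [Set.mem_ofPred_eq]; omega)
        (by simp) (by simpa using e)
      omega
    · have := hDC.1.getVert_injOn (x₁ := j) (x₂ := D.length)
        (by simp only [Set.mem_ofPred_eq]; omega) (by simp) (by simpa using e)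
      omega
  have hoff : ∀ t, c t ≠ x := fun t e => hx.1 (e ▸ h.mem_support t)
  -- Otherwise all neighbours of `x` in `C` lie on the three-vertex path centred at `c 1`.
  have hL3 : 3 ≤ (C.length : ℤ) - D.length := by
    by_contra hh
    obtain ⟨s, s1, s2, s3, s4, s5, s6, -⟩ := h.exists_of_isMajor hx (C.length - D.length) 1
    have : 0 ≤ s := by
      by_contra hneg
      exact hxD s (by omega) (by omega) s3
    omega
  have hnoHole : ∀ (y : V) (C' : G.Walk y y), IsHole C' → Odd C'.length → ℓ ≤ C'.length →
      (C.length : ℤ) ≤ C'.length := fun y C' h1 h2 h3 => by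
    exact_mod_cast hmin y C' ⟨h1, h3, h2⟩
  -- If `D` were odd, `x` would close it to a long odd hole with two edges more than `D`, shorter
  -- than `C` by the previous bound.
  have hkeven : (D.length : ℤ) % 2 = 0 := by
    by_contra hodd
    obtain ⟨l, hl, ml, nl⟩ := h.cyc.seg_up (-(D.length : ℤ)) 0 (by omega) (by omega)
    obtain ⟨C', hC', hlen'⟩ := hl.exists_hole (y := x) (by omega) (hLk ▸ hL) h0 fun z hz => by
      obtain ⟨t, t1, t2, rfl⟩ := (ml z).1 hz
      refine ⟨hoff t, fun hxt => ?_⟩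
      by_cases e1 : t = 0
      · right; rw [e1]
      · left
        by_contra hne
        have : t ≠ -(D.length : ℤ) := by rintro rfl; exact hne rfl
        exact hxD t (by omega) (by omega) hxt
    have := hnoHole x C' hC' (by rw [Nat.odd_iff]; omega) (by omega)
    omega
  exact ⟨hℓ, h.cyc, hG.1, hnoHole, by ring, by exact_mod_cast hlen, hL3, hkeven, by omega, hoff,
    h0, hL, hxD⟩

theorem Coord.evenMajor (h : Coord C c) (F : Frame G ℓ C.length D.length (C.length - D.length) c x)
    (hD : IsRemoteBase ℓ C x D)
    (hDc : ∀ j : ℕ, j ≤ D.length → D.getVert j = c (-j)) {v : V} (hv : IsMajor C v)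
    (hvx : v ≠ x) (hnx : ¬ G.Adj x v) (hpar : HasEvenParity C x v) :
    EvenMajor G ℓ C.length D.length (C.length - D.length) c x v := by
  have hk := F.k_ge; have h5 := F.five_le; have hL := F.L_ge
  have hxC : x ∉ C.support := hD.1.1.1
  have hd₁ : d₁ = c 0 := by simpa using hDc 0 (by omega)
  have hd₂ : d₂ = c (-(D.length : ℤ)) := by simpa using hDc D.length le_rfl
  have hLk : c (C.length - D.length) = c (-(D.length : ℤ)) :=
    h.cyc.eq_of_dvd ⟨1, by ring⟩
  have hloc : ∀ t : ℤ, -(D.length : ℤ) ≤ t → t ≤ C.length - D.length → G.Adj v (c t) →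
      (ℓ ≤ t ∧ t ≤ C.length - D.length - ℓ) ∨ (ℓ - D.length ≤ t ∧ t ≤ -ℓ) := by
    intro t h1 h2 h3
    have hr : ∀ i : ℤ, (c i = d₁ ∨ c i = d₂) → ¬ (t - i < ℓ ∧ i - t < ℓ) := by
      intro i hi hlt
      refine hD.2.2 ⟨v, c t, hv, hvx, h.mem_support t, h3, ?_⟩
      rcases hi with hi | hi
      · left; rw [← hi]; exact h.dist_lt hlt.1 hlt.2
      · right; rw [← hi]; exact h.dist_lt hlt.1 hlt.2
    have r1 := hr 0 (.inl hd₁.symm)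
    have r2 := hr (-(D.length : ℤ)) (.inr hd₂.symm)
    have r3 := hr (C.length - D.length) (.inr (hLk.trans hd₂.symm))
    omega
  have hwrap : ∀ t, c (t - C.length) = c t := fun t => h.cyc.eq_of_dvd ⟨-1, by ring⟩
  refine ⟨fun t e => hv.1 (e ▸ h.mem_support t), hvx, hnx, fun t => ?_, hloc, ?_, ?_, ?_⟩
  · obtain ⟨s, s1, s2, s3, -, -, -, s4⟩ := h.exists_of_isMajor hv (C.length - D.length) t
    exact ⟨s, by omega, s2, s3, s4⟩
  -- Without a neighbour in `D`, `v` spans the path of `C` that runs from its last neighbour `c b`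
  -- in `E` through `D` to its first one `c a`. This path properly contains `D`, against maximality.
  · by_contra! hno
    have hE : ∃ t, 0 ≤ t ∧ t ≤ (C.length : ℤ) - D.length ∧ G.Adj v (c t) := by
      obtain ⟨s, s1, s2, s3, -⟩ := h.exists_of_isMajor hv (C.length - D.length) 0
      refine ⟨s, ?_, s2, s3⟩
      by_contra hneg
      exact hno s (by omega) (by omega) s3
    obtain ⟨a, a1, a2, a3, a4⟩ := exists_first hE
    obtain ⟨b, b1, b2, b3, b4⟩ := exists_last hE
    have hall : ∀ s, -(D.length : ℤ) ≤ s → s ≤ C.length - D.length → G.Adj v (c s) →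
        a ≤ s ∧ s ≤ b := by
      intro s s1 s2 s3
      have : 0 ≤ s := by
        by_contra hneg
        exact hno s (by omega) (by omega) s3
      constructor
      · by_contra hh; exact a4 s this (by omega) s3
      · by_contra hh; exact b4 s (by omega) s2 s3
    have hab : a + 3 ≤ b := by
      by_contra hh
      obtain ⟨s, s1, s2, s3, s4, s5, s6, -⟩ :=
        h.exists_of_isMajor hv (C.length - D.length) (a + 1)
      have := hall s (by omega) s2 s3
      omega
    have hla := hloc a (by omega) a2 a3
    have hlb := hloc b (by omega) b2 b3
    obtain ⟨P, p1, p2, p3, p4⟩ := h.exists_walk b (a + C.length) (by omega) (by omega)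
    have hDP : ∀ w ∈ D.support, w ∈ P.support := by
      intro w hw
      obtain ⟨j, rfl, hj⟩ := Walk.mem_support_iff_exists_getVert.1 hw
      rw [hDc j hj, p4]
      exact ⟨-j + C.length, by omega, by omega, (h.cyc.per _).symm⟩
    have hDPs : D.toSubgraph ≤ P.toSubgraph := by
      refine ⟨fun w hw => by simpa using hDP w (by simpa using hw), fun w w' hww => ?_⟩
      have h1 := D.toSubgraph.edge_vert hww
      have h2 := D.toSubgraph.edge_vert hww.symm
      exact p2.2 (by simpa using hDP _ (by simpa using h1))
        (by simpa using hDP _ (by simpa using h2)) hww.adj_sub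
    have heq := hD.1.2.2 v _ _ P hv ⟨p1, b3, by rw [h.cyc.per]; exact a3, fun w hw hvw => ?_⟩ hDPs
    · have hbP : c b ∈ P.toSubgraph.verts := by simp
      rw [heq, Walk.mem_verts_toSubgraph, Walk.mem_support_iff_exists_getVert] at hbP
      obtain ⟨j, hj, hjD⟩ := hbP
      rw [hDc j hjD] at hj
      have := h.cyc.eq_cases hj (by omega) (by omega)
      omega
    · obtain ⟨hw1, hw2, hw3⟩ := hw
      obtain ⟨t, t1, t2, rfl⟩ := (p4 w).1 hw1
      have ht1 : t ≠ b := by rintro rfl; exact hw2 rfl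
      have ht2 : t ≠ a + C.length := by rintro rfl; exact hw3 rfl
      rcases le_or_gt t (C.length - D.length) with ht | ht
      · have := hall t (by omega) ht hvw; omega
      · have := hall (t - C.length) (by omega) (by omega) (by rwa [hwrap]); omega
  · intro i j hij hn hxi hvj hx' hv'
    obtain ⟨l, hl, ml, nl⟩ := h.cyc.seg_up i j hij hn
    have := h.even_of_gap hl (fun y hy => by
      obtain ⟨t, -, -, rfl⟩ := (ml y).1 hy; exact h.mem_support t) hxC hv.1 hvx hnx hxi hvj
      (fun y hy hne => by
        obtain ⟨t, t1, t2, rfl⟩ := (ml y).1 hy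
        have : t ≠ i := by rintro rfl; exact hne rfl
        exact hx' t (by omega) t2)
      (fun y hy hne => by
        obtain ⟨t, t1, t2, rfl⟩ := (ml y).1 hy
        have : t ≠ j := by rintro rfl; exact hne rfl
        exact hv' t t1 (by omega)) hpar
    omega
  · intro i j hij hn hvi hxj hv' hx'
    obtain ⟨l, hl, ml, nl⟩ := h.cyc.seg_down i j hij hn
    have := h.even_of_gap hl (fun y hy => by
      obtain ⟨t, -, -, rfl⟩ := (ml y).1 hy; exact h.mem_support t) hxC hv.1 hvx hnx hxj hvi
      (fun y hy hne => by
        obtain ⟨t, t1, t2, rfl⟩ := (ml y).1 hy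
        have : t ≠ j := by rintro rfl; exact hne rfl
        exact hx' t t1 (by omega))
      (fun y hy hne => by
        obtain ⟨t, t1, t2, rfl⟩ := (ml y).1 hy
        have : t ≠ i := by rintro rfl; exact hne rfl
        exact hv' t (by omega) t2) hpar
    omega

end

end LongOddHole

/-! ### The five catching paths -/

theorem theorem6p2 {V : Type*} [Finite V] (G : SimpleGraph V) (ℓ : ℕ) (hℓ : 5 ≤ ℓ)
    (hG : LongOddHole.IsCandidate ℓ G)
    {u : V} (C : G.Walk u u) (hC : LongOddHole.IsShortestLongOddHole ℓ C)
    (x : V) {d₁ d₂ : V} (D : G.Walk d₁ d₂) (hD : LongOddHole.IsRemoteBase ℓ C x D) :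
    ∃ F : Set (LongOddHole.PathOf C),
      LongOddHole.cost F ≤ 5 * ℓ + 12 ∧
      ∀ v : V, LongOddHole.IsMajor C v → v ≠ x → ¬ G.Adj x v →
        LongOddHole.HasEvenParity C x v → ∃ P ∈ F, P.Catches v := by
  classical
  open LongOddHole in
  obtain ⟨c, hc, hDc⟩ := exists_coord_along hC.1.1 hD.1.2.1.1
  have F := hc.frame hℓ hG hC hD hDc
  obtain ⟨a, m, z, g, p, hpos⟩ := F.exists_positions
  have hk := F.k_ge
  have hL := F.L_ge
  -- Each path is an interval of positions with an extra vertex at each end, so that the positions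
  -- become internal. The index counts are three times `ℓ + 2`, once `2 * ℓ + 1`, and `3` for the
  -- common neighbour: `5 * ℓ + 10` in all.
  obtain ⟨P₁, s₁, i₁⟩ := hc.exists_pathOf (a - ℓ) (a + 1) (by omega) (by omega)
  obtain ⟨P₂, s₂, i₂⟩ := hc.exists_pathOf (m - ℓ) (m + ℓ) (by omega) (by omega)
  obtain ⟨P₃, s₃, i₃⟩ := hc.exists_pathOf (z - ℓ) (z + 1) (by omega) (by omega)
  obtain ⟨P₄, s₄, i₄⟩ := hc.exists_pathOf (g - ℓ) (g + 1) (by omega) (by omega)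
  obtain ⟨P₅, s₅, i₅⟩ := hc.exists_pathOf (-p - 1) (-p + 1) (by omega) (by omega)
  have hoff : ∀ (P : LongOddHole.PathOf C) (v : V), LongOddHole.IsMajor C v →
      v ∉ P.walk.support := by
    intro P v hv hP
    have := P.isPathOf.2.1 (show v ∈ P.walk.toSubgraph.verts by simpa using hP)
    exact hv.1 (by simpa using this)
  refine ⟨{P₁, P₂, P₃, P₄, P₅}, ?_, fun v hv hvx hnx hpar => ?_⟩
  · let T : Finset ℤ := Finset.Icc (a - ℓ) (a + 1) ∪ (Finset.Icc (m - ℓ) (m + ℓ) ∪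
      (Finset.Icc (z - ℓ) (z + 1) ∪ (Finset.Icc (g - ℓ) (g + 1) ∪ Finset.Icc (-p - 1) (-p + 1))))
    have hsub : {w : V | ∃ P ∈ ({P₁, P₂, P₃, P₄, P₅} : Set (LongOddHole.PathOf C)),
        w ∈ P.walk.support} ⊆ (T.image c : Finset V) := by
      rintro w ⟨P, hP, hw⟩
      simp only [Set.mem_insert_iff, Set.mem_singleton_iff] at hP
      have : ∃ t ∈ T, w = c t := by
        rcases hP with rfl | rfl | rfl | rfl | rfl
        · obtain ⟨t, h1, h2, h3⟩ := s₁ w hw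
          exact ⟨t, by simp only [T, Finset.mem_union, Finset.mem_Icc]; omega, h3⟩
        · obtain ⟨t, h1, h2, h3⟩ := s₂ w hw
          exact ⟨t, by simp only [T, Finset.mem_union, Finset.mem_Icc]; omega, h3⟩
        · obtain ⟨t, h1, h2, h3⟩ := s₃ w hw
          exact ⟨t, by simp only [T, Finset.mem_union, Finset.mem_Icc]; omega, h3⟩
        · obtain ⟨t, h1, h2, h3⟩ := s₄ w hw
          exact ⟨t, by simp only [T, Finset.mem_union, Finset.mem_Icc]; omega, h3⟩
        · obtain ⟨t, h1, h2, h3⟩ := s₅ w hw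
          exact ⟨t, by simp only [T, Finset.mem_union, Finset.mem_Icc]; omega, h3⟩
      obtain ⟨t, ht, rfl⟩ := this
      simpa using ⟨t, ht, rfl⟩
    have h1 := Set.ncard_le_ncard hsub (Finset.finite_toSet _)
    rw [Set.ncard_coe_finset] at h1
    have h2 : T.card ≤ 5 * ℓ + 12 := by
      refine (Finset.card_union_le _ _).trans ?_
      refine (Nat.add_le_add_left (Finset.card_union_le _ _) _).trans ?_
      refine (Nat.add_le_add_left (Nat.add_le_add_left (Finset.card_union_le _ _) _) _).trans ?_
      refine (Nat.add_le_add_left (Nat.add_le_add_left (Nat.add_le_add_left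
        (Finset.card_union_le _ _) _) _) _).trans ?_
      simp only [Int.card_Icc]
      omega
    exact h1.trans (Finset.card_image_le.trans h2)
  · have hem := hc.evenMajor F hD hDc hv hvx hnx hpar
    rcases hpos v hem with ⟨t, ht, h | h | h | h⟩ | h
    · exact ⟨P₁, by simp, hoff _ v hv, c t, i₁ t (by omega) (by omega), ht⟩
    · exact ⟨P₂, by simp, hoff _ v hv, c t, i₂ t (by omega) (by omega), ht⟩
    · exact ⟨P₃, by simp, hoff _ v hv, c t, i₃ t (by omega) (by omega), ht⟩
    · exact ⟨P₄, by simp, hoff _ v hv, c t, i₄ t (by omega) (by omega), ht⟩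
    · exact ⟨P₅, by simp, hoff _ v hv, _, i₅ (-p) (by omega) (by omega), h⟩
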